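/- Let $m\ge 1$ be an integer and $\alpha>0$ a real number. Let $\nu_{\alpha,1}$ be the probability measure on the simplex $\{\Lambda=(\lambda_1,\dots,\lambda_m): \lambda_j\ge 0,\ \sum_j\lambda_j=1\}$ given by $$d\nu_{\alpha,1}(\Lambda)=C\,\delta\Bigl(1-\sum_{j=1}^m\lambda_j\Bigr)\prod_{1\le i<j\le m}(\lambda_i-\lambda_j)^2\prod_{j=1}^m\lambda_j^{\alpha-1}\,d\lambda_j ,$$ where $C$ is the normalization constant, and let $\mu_{\alpha,1}$ be the law of the random $m\times m$ density matrix $\rho=U\,\mathrm{diag}(\Lambda)\,U^\dagger$, where $\Lambda$ has law $\nu_{\alpha,1}$ and $U$ is an independent Haar-distributed unitary. For a density matrix $\rho$ with eigenvalues $\Lambda=(\lambda_1,\dots,\lambda_m)$ let $$Q(\rho)=Q(\Lambda)=-\sum_{i=1}^m\frac{\lambda_i^m\ln\lambda_i}{\prod_{j\ne i}(\lambda_i-\lambda_j)}$$ be its subentropy (with $0^m\ln 0=0$, and defined as the limit along spectra with distinct entries when eigenvalues coincide). Then $\nu_{\alpha,1}$ is indeed a well-defined probability measure, $Q$ is integrable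 with respect to $\nu_{\alpha,1}$ and $\mu_{\alpha,1}$, and the average subentropy is $$\int Q(\rho)\,d\mu_{\alpha,1}(\rho)=\int Q(\Lambda)\,d\nu_{\alpha,1}(\Lambda)=\frac{1}{m(m+\alpha-1)}\sum_{k=0}^{m-1}g_{mk}(\alpha)\,u_{mk}(\alpha),$$ where $$g_{mk}(\alpha)=\psi\bigl(m(m+\alpha-1)+1\bigr)-\psi\bigl(2(m-1)+\alpha+1-k\bigr),$$ $$u_{mk}(\alpha)=\frac{(-1)^k\,\Gamma\bigl(2(m-1)+\alpha+1-k\bigr)}{\Gamma(k+1)\,\Gamma(m-k)\,\Gamma(m+\alpha-1-k)},$$ and $\psi(z)=\frac{d}{dz}\ln\Gamma(z)$ is the digamma function. -/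

import Mathlib

open MeasureTheory Filter Topology
open scoped ENNReal

noncomputable section

namespace RandomState

/-! ### Subentropy -/

/-- The probability simplex, as a set of vectors `(λ_1, …, λ_m)`. -/
def simplex (m : ℕ) : Set (Fin m → ℝ) := {x | (∀ i, 0 ≤ x i) ∧ ∑ i, x i = 1}

/-- The defining expression of the subentropy for pairwise distinct eigenvalues:
`- ∑ i, λ_i ^ m (∏_{j ≠ i} (λ_i - λ_j))⁻¹ ln λ_i` (with `0 ^ m ln 0 = 0`). -/
def subentropyFormula {m : ℕ} (x : Fin m → ℝ) : ℝ :=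
  - ∑ i, x i ^ m * (∏ j ∈ Finset.univ.erase i, (x i - x j))⁻¹ * Real.log (x i)

open Classical in
/-- The subentropy `Q(Λ)` of a spectrum `Λ` in the simplex. If two or more of the eigenvalues are
equal, the value is the limit of the expression above along spectra with distinct entries. -/
def subentropy {m : ℕ} (x : Fin m → ℝ) : ℝ :=
  if Function.Injective x then subentropyFormula x
  else limUnder (𝓝[{y | y ∈ simplex m ∧ Function.Injective y}] x) subentropyFormula

open Classical in
/-- The subentropy `Q(ρ)` of a density matrix: the subentropy of its eigenvalues, counted with
multiplicity. (Matrices that are not Hermitian get the value `0`; they play no role.) -/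
def matrixSubentropy {m : ℕ} (ρ : Matrix (Fin m) (Fin m) ℂ) : ℝ :=
  if h : ρ.IsHermitian then subentropy h.eigenvalues else 0

/-! ### The eigenvalue measures -/

/-- The point `(x_1, …, x_{m-1}, 1 - x_1 - ⋯ - x_{m-1})` of the hyperplane `∑ λ_j = 1`. -/
def hyperplanePoint (m : ℕ) (x : Fin (m - 1) → ℝ) : Fin m → ℝ :=
  fun i => if h : (i : ℕ) < m - 1 then x ⟨i, h⟩ else 1 - ∑ j, x j

/-- For `m ≥ 1`, the measure `δ(1 - ∑ λ_j) dλ_1 ⋯ dλ_m` on `ℝ ^ m`, carried by the hyperplane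
`∑ λ_j = 1`: the delta function removes the integration over the last variable. -/
def deltaMeasure (m : ℕ) : Measure (Fin m → ℝ) :=
  (volume : Measure (Fin (m - 1) → ℝ)).map (hyperplanePoint m)

/-- The Vandermonde product `Δ(λ) = ∏_{i < j} (λ_i - λ_j)`. -/
def vandermondeProd {m : ℕ} (x : Fin m → ℝ) : ℝ :=
  ∏ i, ∏ j ∈ Finset.Ioi i, (x i - x j)

/-- The weight `|Δ(λ)| ^ (2γ) ∏_j λ_j ^ (α - 1)`. -/
def weight {m : ℕ} (α γ : ℝ) (x : Fin m → ℝ) : ℝ :=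
  |vandermondeProd x| ^ (2 * γ) * ∏ j, x j ^ (α - 1)

/-- The measure `δ(1 - ∑ λ_j) |Δ(λ)| ^ (2γ) ∏_j λ_j ^ (α - 1) dλ_j` on `[0, ∞) ^ m`. -/
def unnormalizedEigenvalueMeasure (m : ℕ) (α γ : ℝ) : Measure (Fin m → ℝ) :=
  ((deltaMeasure m).restrict {x | ∀ i, 0 ≤ x i}).withDensity fun x => ENNReal.ofReal (weight α γ x)

/-- The eigenvalue measure `ν_{α,γ}`: the measure above divided by its total mass. -/
def eigenvalueMeasure (m : ℕ) (α γ : ℝ) : Measure (Fin m → ℝ) :=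
  (unnormalizedEigenvalueMeasure m α γ Set.univ)⁻¹ • unnormalizedEigenvalueMeasure m α γ

/-! ### The measures on density matrices -/

instance matrixMeasurableSpace (m : ℕ) : MeasurableSpace (Matrix (Fin m) (Fin m) ℂ) := borel _

instance matrixBorelSpace (m : ℕ) : BorelSpace (Matrix (Fin m) (Fin m) ℂ) := ⟨rfl⟩

instance unitaryGroupCompactSpace (m : ℕ) : CompactSpace (Matrix.unitaryGroup (Fin m) ℂ) := by
  have hb : IsCompact (Set.pi Set.univ fun _ : Fin m => Set.pi Set.univ fun _ : Fin m =>
      Metric.closedBall (0 : ℂ) 1) :=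
    isCompact_univ_pi fun _ => isCompact_univ_pi fun _ => isCompact_closedBall _ _
  refine isCompact_iff_compactSpace.mp (IsCompact.of_isClosed_subset (X := Matrix (Fin m) (Fin m) ℂ) hb isClosed_unitary ?_)
  intro U hU i _ j _
  simpa using entry_norm_bound_of_unitary hU i j

/-- The normalized Haar measure on the unitary group `U(m)`. -/
def unitaryHaar (m : ℕ) : Measure (Matrix.unitaryGroup (Fin m) ℂ) := Measure.haarMeasure ⊤

/-- The matrix `U Λ U†`, with `Λ = diag(λ_1, …, λ_m)`. -/
def conjDiagonal {m : ℕ} (x : Fin m → ℝ) (U : Matrix.unitaryGroup (Fin m) ℂ) :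
    Matrix (Fin m) (Fin m) ℂ :=
  (U : Matrix (Fin m) (Fin m) ℂ) * Matrix.diagonal (fun i => (x i : ℂ)) *
    (U : Matrix (Fin m) (Fin m) ℂ).conjTranspose

/-- The measure `μ_{α,γ}` on density matrices: the law of `ρ = U Λ U†` with `Λ` distributed
according to `ν_{α,γ}` and `U` independent and Haar distributed. -/
def stateMeasure (m : ℕ) (α γ : ℝ) : Measure (Matrix (Fin m) (Fin m) ℂ) :=
  ((eigenvalueMeasure m α γ).prod (unitaryHaar m)).map fun p => conjDiagonal p.1 p.2

/-! ### The closed form -/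

/-- The digamma function `ψ(z) = d ln Γ(z) / dz`, for `z > 0`. -/
def digamma (z : ℝ) : ℝ := deriv (fun t => Real.log (Real.Gamma t)) z

/-- `g_{mk}(α) = ψ(m(m+α-1)+1) - ψ(2(m-1)+α+1-k)`. -/
def g (m k : ℕ) (α : ℝ) : ℝ :=
  digamma (m * (m + α - 1) + 1) - digamma (2 * ((m : ℝ) - 1) + α + 1 - k)

/-- `u_{mk}(α) = (-1)^k Γ(2(m-1)+α+1-k) / (Γ(k+1) Γ(m-k) Γ(m+α-1-k))`. -/
def u (m k : ℕ) (α : ℝ) : ℝ :=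
  (-1) ^ k * Real.Gamma (2 * ((m : ℝ) - 1) + α + 1 - k) /
    (Real.Gamma (k + 1) * Real.Gamma (m - k) * Real.Gamma (m + α - 1 - k))

end RandomState

end

/-!
# The mean subentropy of a random density matrix

The normalization on the simplex is removed by multiplying the spectrum `Λ` by an independent
gamma variable `s` with parameter `N = m (m + α - 1)`: the vector `x = s Λ` then follows the
Laguerre ensemble, with density proportional to `Δ(x) ^ 2 ∏ x_i ^ (α - 1) e ^ (-x_i)` on the orthant
(`map_smul_radialMeasure_prod_simplexMeasure`, `laguerreWeight_smul`). The defining expression of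
the subentropy is minus the divided difference of `t ^ m ln t` at the eigenvalues, and it satisfies
`Q(s Λ) = s Q(Λ) - s ln s` (`subentropyFormula_smul`), because the divided difference of `t ^ m` is
the sum of the eigenvalues. So the mean of `Q` on the simplex follows from its mean over the
Laguerre ensemble.

For any function `f`, the divided difference `f[x]` times the Vandermonde determinant is the
determinant with rows `(1, x_i, …, x_i ^ (m - 2), f (x_i))` (`det_borderedVandermonde`). Multiplied
by a second Vandermonde determinant whose last column has been replaced by the Laguerre polynomial
`L` of degree `m - 1`, it can be integrated by Andréief's identity (`integral_det_mul_det`).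
Orthogonality kills the last column except for its last entry, so the integral is
`c ∫ f(t) L(t) t ^ (α - 1) e ^ (-t) dt` with `c` independent of `f`
(`exists_integral_dividedDifference`). Taking `f = t ^ (m - 1)`, `t ^ m` and `t ^ m ln t` gives
respectively the normalization, the mean `N` of `∑ x_i` (that is, `∑ k, u m k α = N`), and the
mean of `-Q(x)`; the last integral is a combination of the derivatives `Γ' = Γ ψ`.

Coinciding eigenvalues do not matter, since the weight vanishes there. For the matrix ensemble, the
only further point is the measurability of `Q(ρ)`, which is inherited from that of `Q(Λ)` along the
Borel surjection `(Λ, U) ↦ U Λ U†` onto the Hermitian matrices.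
-/

noncomputable section

namespace RandomState

/-! ### Divided differences and bordered Vandermonde determinants -/

/-- The divided difference `f[x_1, …, x_m] = ∑ i, f (x_i) / ∏_{j ≠ i} (x_i - x_j)`. It is the
divided difference only at pairwise distinct nodes. -/
def dividedDifference {m : ℕ} (f : ℝ → ℝ) (x : Fin m → ℝ) : ℝ :=
  ∑ i, f (x i) * (∏ j ∈ Finset.univ.erase i, (x i - x j))⁻¹

/-- The functions `1, t, …, t ^ (n - 1), f`. -/
def monomialsSnoc (n : ℕ) (f : ℝ → ℝ) : Fin (n + 1) → ℝ → ℝ :=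
  Fin.snoc (α := fun _ => ℝ → ℝ) (fun j t => t ^ (j : ℕ)) f

@[simp]
lemma monomialsSnoc_castSucc (n : ℕ) (f : ℝ → ℝ) (j : Fin n) :
    monomialsSnoc n f j.castSucc = fun t => t ^ (j : ℕ) := by
  simp [monomialsSnoc]

@[simp]
lemma monomialsSnoc_last (n : ℕ) (f : ℝ → ℝ) : monomialsSnoc n f (Fin.last n) = f := by
  simp [monomialsSnoc]

/-- The matrix with rows `(1, x_i, …, x_i ^ (n - 1), f (x_i))`. -/
def borderedVandermonde {n : ℕ} (f : ℝ → ℝ) (x : Fin (n + 1) → ℝ) :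
    Matrix (Fin (n + 1)) (Fin (n + 1)) ℝ :=
  Matrix.of fun i j => monomialsSnoc n f j (x i)

open Polynomial in
lemma det_borderedVandermonde_eval {n : ℕ} (P : ℝ[X]) (hP : P.natDegree ≤ n)
    (x : Fin (n + 1) → ℝ) :
    (borderedVandermonde (fun t => P.eval t) x).det = P.coeff n * (Matrix.vandermonde x).det := by
  let p : Fin (n + 1) → ℝ[X] := Fin.snoc (α := fun _ => ℝ[X]) (fun j => X ^ (j : ℕ)) P
  have hpc : ∀ j : Fin n, p j.castSucc = X ^ (j : ℕ) := fun j => by simp [p]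
  have hpl : p (Fin.last n) = P := by simp [p]
  have hdeg : ∀ j, (p j).natDegree ≤ j := by
    intro j
    refine Fin.lastCases ?_ (fun j => ?_) j
    · simpa [hpl] using hP
    · simp [hpc]
  have hM : borderedVandermonde (fun t => P.eval t) x =
      Matrix.of fun i j => (p j).eval (x i) := by
    ext i j
    refine Fin.lastCases ?_ (fun j => ?_) j
    · simp [borderedVandermonde, hpl]
    · simp [borderedVandermonde, hpc]
  rw [hM, Matrix.eval_matrixOfPolynomials_eq_vandermonde_mul_matrixOfPolynomials x p hdeg,
    Matrix.det_mul,
    Matrix.det_of_isUpperTriangular (Matrix.matrixOfPolynomials_blockTriangular p hdeg),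
    Fin.prod_univ_castSucc]
  simp [hpc, hpl, mul_comm]

/-- The divided difference only depends on the interpolation polynomial, whose top coefficient
it is; column operations then turn the bordered matrix into a Vandermonde matrix. -/
lemma det_borderedVandermonde {n : ℕ} (f : ℝ → ℝ) {x : Fin (n + 1) → ℝ}
    (hx : Function.Injective x) :
    (borderedVandermonde f x).det = dividedDifference f x * (Matrix.vandermonde x).det := by
  have hinj : Set.InjOn x (Finset.univ : Finset (Fin (n + 1))) := hx.injOn
  set P := Lagrange.interpolate Finset.univ x (fun i => f (x i)) with hP
  have heval : ∀ i, P.eval (x i) = f (x i) := fun i =>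
    Lagrange.eval_interpolate_at_node _ hinj (Finset.mem_univ i)
  have hdeg : P.degree < (Finset.univ : Finset (Fin (n + 1))).card :=
    Lagrange.degree_interpolate_lt _ hinj
  have hnat : P.natDegree ≤ n := by
    rw [Finset.card_univ, Fintype.card_fin] at hdeg
    exact Polynomial.natDegree_le_iff_coeff_eq_zero.mpr fun N hN =>
      (Polynomial.degree_lt_iff_coeff_zero _ _).mp hdeg N hN
  have hcoeff := Lagrange.coeff_eq_sum hinj hdeg
  have hM : borderedVandermonde f x = borderedVandermonde (fun t => P.eval t) x := by
    ext i j
    refine Fin.lastCases ?_ (fun j => ?_) j <;> simp [borderedVandermonde, heval]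
  rw [hM, det_borderedVandermonde_eval P hnat]
  congr 1
  simpa [dividedDifference, heval, div_eq_mul_inv] using hcoeff

lemma dividedDifference_polynomial {n : ℕ} (P : Polynomial ℝ) (hP : P.natDegree ≤ n)
    {x : Fin (n + 1) → ℝ} (hx : Function.Injective x) :
    dividedDifference (fun t => P.eval t) x = P.coeff n := by
  have h1 := det_borderedVandermonde (fun t => P.eval t) hx
  rw [det_borderedVandermonde_eval P hP] at h1
  exact (mul_right_cancel₀ (Matrix.det_vandermonde_ne_zero_iff.mpr hx) h1).symm

lemma dividedDifference_pow {n : ℕ} {x : Fin (n + 1) → ℝ} (hx : Function.Injective x) :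
    dividedDifference (fun t => t ^ n) x = 1 := by
  have := dividedDifference_polynomial (n := n) (Polynomial.X ^ n) (by simp) hx
  simpa using this

open Polynomial in
/-- Modulo `∏ (X - x_i)`, which vanishes at the nodes, `X ^ (n + 1)` has degree at most `n` and top
coefficient `∑ x_i`. -/
lemma dividedDifference_pow_succ {n : ℕ} {x : Fin (n + 1) → ℝ} (hx : Function.Injective x) :
    dividedDifference (fun t => t ^ (n + 1)) x = ∑ i, x i := by
  set R : ℝ[X] := ∏ i, (X - C (x i)) with hR
  have hmonic : R.Monic := monic_prod_of_monic _ _ fun i _ => monic_X_sub_C _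
  have hRdeg : R.natDegree = n + 1 := by
    rw [hR, natDegree_prod_of_monic _ _ fun i _ => monic_X_sub_C _]; simp
  have hRcoeff : R.coeff n = -∑ i, x i := by
    have := Polynomial.prod_X_sub_C_coeff_card_pred (Finset.univ : Finset (Fin (n + 1))) x
      (by simp)
    simpa using this
  have hdeg : (X ^ (n + 1) - R).natDegree ≤ n := by
    rw [Polynomial.natDegree_le_iff_coeff_eq_zero]
    intro N hN
    rcases Nat.lt_or_ge (n + 1) N with h | h
    · rw [coeff_sub, coeff_X_pow, coeff_eq_zero_of_natDegree_lt (by omega : R.natDegree < N)]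
      simp; omega
    · obtain rfl : N = n + 1 := by omega
      have : R.coeff (n + 1) = 1 := by rw [← hRdeg]; exact hmonic
      simp [this]
  have h := dividedDifference_polynomial _ hdeg hx
  rw [coeff_sub, hRcoeff, coeff_X_pow] at h
  have hz : ∀ i, R.eval (x i) = 0 := fun i => by
    rw [hR, eval_prod]; exact Finset.prod_eq_zero (Finset.mem_univ i) (by simp)
  simpa [dividedDifference, hz] using h

lemma dividedDifference_comp_perm {m : ℕ} (f : ℝ → ℝ) (x : Fin m → ℝ) (σ : Equiv.Perm (Fin m)) :
    dividedDifference f (x ∘ σ) = dividedDifference f x := by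
  unfold dividedDifference
  rw [← Equiv.sum_comp σ (fun i => f (x i) * _)]
  refine Finset.sum_congr rfl fun i _ => ?_
  congr 2
  refine Finset.prod_bij (fun j _ => σ j) ?_ ?_ ?_ ?_
  · intro j hj; simpa using hj
  · intro a _ b _ h; exact σ.injective h
  · intro b hb; exact ⟨σ.symm b, by simpa [Equiv.symm_apply_eq] using hb, by simp⟩
  · intro j _; rfl

lemma subentropyFormula_eq_neg_dividedDifference {m : ℕ} (x : Fin m → ℝ) :
    subentropyFormula x = -dividedDifference (fun t => t ^ m * Real.log t) x := by
  unfold subentropyFormula dividedDifference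
  congr 1
  exact Finset.sum_congr rfl fun i _ => by ring

lemma vandermondeProd_sq {m : ℕ} (x : Fin m → ℝ) :
    vandermondeProd x ^ 2 = (Matrix.vandermonde x).det ^ 2 := by
  rw [Matrix.det_vandermonde, vandermondeProd, ← Finset.prod_pow, ← Finset.prod_pow]
  refine Finset.prod_congr rfl fun i _ => ?_
  rw [← Finset.prod_pow, ← Finset.prod_pow]
  exact Finset.prod_congr rfl fun j _ => by ring

lemma weight_one {m : ℕ} (α : ℝ) (x : Fin m → ℝ) :
    weight α 1 x = (Matrix.vandermonde x).det ^ 2 * ∏ j, x j ^ (α - 1) := by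
  rw [weight, mul_one, Real.rpow_two, sq_abs, vandermondeProd_sq]

lemma weight_eq_zero_of_not_injective {m : ℕ} (α : ℝ) {x : Fin m → ℝ}
    (hx : ¬ Function.Injective x) : weight α 1 x = 0 := by
  rw [weight_one, Matrix.det_vandermonde_eq_zero_iff.mpr (by
    simpa [Function.Injective, and_comm] using hx)]
  simp

/-- Both sides vanish at coinciding nodes, whatever the value of `dividedDifference` there. -/
lemma dividedDifference_mul_weight {n : ℕ} (α : ℝ) (f : ℝ → ℝ) (x : Fin (n + 1) → ℝ) :
    dividedDifference f x * weight α 1 x =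
      (borderedVandermonde f x).det * (Matrix.vandermonde x).det * ∏ j, x j ^ (α - 1) := by
  by_cases hx : Function.Injective x
  · rw [weight_one, det_borderedVandermonde f hx]; ring
  · have h0 : (Matrix.vandermonde x).det = 0 := Matrix.det_vandermonde_eq_zero_iff.mpr (by
      simpa [Function.Injective, and_comm] using hx)
    rw [weight_eq_zero_of_not_injective α hx, h0]; simp

/-! ### Homogeneity -/

/-- Scaling the spectrum by `s` scales the subentropy by `s`, up to the term `s ln s`. -/
lemma subentropyFormula_smul {n : ℕ} {s : ℝ} (hs : 0 < s) {x : Fin (n + 1) → ℝ}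
    (hx : Function.Injective x) (hsum : ∑ i, x i = 1) (hpos : ∀ i, 0 ≤ x i) :
    subentropyFormula (s • x) = s * subentropyFormula x - s * Real.log s := by
  have h1 := dividedDifference_pow_succ hx
  rw [hsum] at h1
  rw [subentropyFormula_eq_neg_dividedDifference, subentropyFormula_eq_neg_dividedDifference]
  suffices h : dividedDifference (fun t => t ^ (n + 1) * Real.log t) (s • x) =
      s * dividedDifference (fun t => t ^ (n + 1) * Real.log t) x +
        s * Real.log s * dividedDifference (fun t => t ^ (n + 1)) x by
    rw [h, h1]; ring
  unfold dividedDifference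
  rw [Finset.mul_sum, Finset.mul_sum, ← Finset.sum_add_distrib]
  refine Finset.sum_congr rfl fun i _ => ?_
  have hprod : ∏ j ∈ Finset.univ.erase i, ((s • x) i - (s • x) j) =
      s ^ n * ∏ j ∈ Finset.univ.erase i, (x i - x j) := by
    simp only [Pi.smul_apply, smul_eq_mul, ← mul_sub]
    rw [Finset.prod_mul_distrib, Finset.prod_const, Finset.card_erase_of_mem (Finset.mem_univ i)]
    simp
  rw [hprod, mul_inv]
  simp only [Pi.smul_apply, smul_eq_mul]
  rcases (hpos i).eq_or_lt with h | h
  · simp [← h]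
  · rw [Real.log_mul hs.ne' h.ne']
    field_simp
    ring

lemma det_vandermonde_smul {n : ℕ} (s : ℝ) (x : Fin (n + 1) → ℝ) :
    (Matrix.vandermonde (s • x)).det ^ 2 =
      s ^ (n * (n + 1)) * (Matrix.vandermonde x).det ^ 2 := by
  have h : Matrix.vandermonde (s • x) =
      Matrix.of fun i j : Fin (n + 1) => s ^ (j : ℕ) * Matrix.vandermonde x i j := by
    ext i j; simp [Matrix.vandermonde_apply, mul_pow]
  rw [h, Matrix.det_mul_row, mul_pow, Finset.prod_pow_eq_pow_sum, ← pow_mul,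
    Fin.sum_univ_eq_sum_range (fun i => i), Finset.sum_range_id_mul_two]
  congr 2
  simp [mul_comm]

lemma weight_smul {n : ℕ} (α : ℝ) {s : ℝ} (hs : 0 < s) {x : Fin (n + 1) → ℝ}
    (hpos : ∀ i, 0 ≤ x i) :
    weight α 1 (s • x) = s ^ ((n + 1) * (n + α - 1)) * weight α 1 x := by
  rw [weight_one, weight_one, det_vandermonde_smul]
  have : ∏ j, (s • x) j ^ (α - 1) = s ^ ((n + 1) * (α - 1)) * ∏ j, x j ^ (α - 1) := by
    simp only [Pi.smul_apply, smul_eq_mul]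
    rw [Finset.prod_congr rfl fun j _ => Real.mul_rpow hs.le (hpos j), Finset.prod_mul_distrib,
      Finset.prod_const, ← Real.rpow_mul_natCast hs.le]
    simp [mul_comm]
  rw [this, show ((n : ℝ) + 1) * (n + α - 1) = ((n * (n + 1) : ℕ) : ℝ) + (n + 1) * (α - 1) by
    push_cast; ring, Real.rpow_add hs, Real.rpow_natCast]
  ring

/-! ### Gamma integrals and Laguerre polynomials -/

/-- The density `t ^ (α - 1) e ^ (-t)` of the gamma distribution, up to normalization. -/
def gammaWeight (α t : ℝ) : ℝ := t ^ (α - 1) * Real.exp (-t)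

lemma pow_mul_gammaWeight (α : ℝ) (k : ℕ) {t : ℝ} (ht : 0 < t) :
    t ^ k * gammaWeight α t = Real.exp (-t) * t ^ (α + k - 1) := by
  rw [gammaWeight, show α + k - 1 = (α - 1) + k by ring, Real.rpow_add ht, Real.rpow_natCast]
  ring

lemma integrableOn_pow_mul_gammaWeight {α : ℝ} (hα : 0 < α) (k : ℕ) :
    IntegrableOn (fun t => t ^ k * gammaWeight α t) (Set.Ioi 0) :=
  (Real.GammaIntegral_convergent (by positivity : 0 < α + k)).congr_fun
    (fun _ ht => (pow_mul_gammaWeight α k ht).symm) measurableSet_Ioi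

lemma integral_pow_mul_gammaWeight {α : ℝ} (hα : 0 < α) (k : ℕ) :
    ∫ t in Set.Ioi 0, t ^ k * gammaWeight α t = Real.Gamma (α + k) := by
  rw [Real.Gamma_eq_integral (by positivity : 0 < α + k)]
  exact setIntegral_congr_fun measurableSet_Ioi fun _ ht => pow_mul_gammaWeight α k ht

/-- Differentiation of the gamma integral under the integral sign. -/
lemma integrableOn_and_integral_log_mul_gammaWeight {s : ℝ} (hs : 0 < s) :
    IntegrableOn (fun t => Real.log t * gammaWeight s t) (Set.Ioi 0) ∧
      ∫ t in Set.Ioi 0, Real.log t * gammaWeight s t = Real.Gamma s * digamma s := by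
  have hkey : ∀ t ∈ Set.Ioi (0 : ℝ),
      (t : ℂ) ^ ((s : ℂ) - 1) * (Real.log t * Real.exp (-t) : ℂ) =
        ((Real.log t * gammaWeight s t : ℝ) : ℂ) := by
    intro t ht
    rw [gammaWeight, show ((s : ℂ) - 1) = ((s - 1 : ℝ) : ℂ) by push_cast; rfl,
      ← Complex.ofReal_cpow (le_of_lt ht)]
    push_cast; ring
  have hs' : 0 < (s : ℂ).re := by simpa using hs
  have hconv : MellinConvergent
      (fun t : ℝ => Real.log t • ((Real.exp (-t) : ℝ) : ℂ)) (s : ℂ) := by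
    refine (mellin_hasDerivAt_of_isBigO_rpow (E := ℂ) (a := s + 1) (b := 0)
      ?_ ?_ (by simp) ?_ hs').1
    · exact ((by fun_prop : Continuous fun t : ℝ => ((Real.exp (-t) : ℝ) : ℂ)).continuousOn
        ).locallyIntegrableOn measurableSet_Ioi
    · rw [← Asymptotics.isBigO_norm_left]
      simp_rw [Complex.norm_real, Asymptotics.isBigO_norm_left]
      simpa only [neg_one_mul] using (isLittleO_exp_neg_mul_rpow_atTop zero_lt_one _).isBigO
    · simp_rw [neg_zero, Real.rpow_zero]
      refine Asymptotics.isBigO_const_of_tendsto (y := ((Real.exp (-0) : ℝ) : ℂ)) ?_ one_ne_zero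
      exact (by fun_prop : Continuous fun t : ℝ => ((Real.exp (-t) : ℝ) : ℂ)).continuousWithinAt
  have hint : IntegrableOn (fun t => Real.log t * gammaWeight s t) (Set.Ioi 0) := by
    have h1 : IntegrableOn (fun t : ℝ => ((Real.log t * gammaWeight s t : ℝ) : ℂ)) (Set.Ioi 0) := by
      refine IntegrableOn.congr_fun hconv (fun t ht => ?_) measurableSet_Ioi
      rw [← hkey t ht]
      simp
    have h2 := h1.re
    simpa [IntegrableOn] using h2
  refine ⟨hint, ?_⟩
  have hd := Complex.hasDerivAt_GammaIntegral hs'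
  rw [setIntegral_congr_fun measurableSet_Ioi hkey, integral_complex_ofReal] at hd
  have hd2 : HasDerivAt Complex.Gamma
      ((∫ t in Set.Ioi 0, Real.log t * gammaWeight s t : ℝ) : ℂ) (s : ℂ) := by
    refine hd.congr_of_eventuallyEq ?_
    filter_upwards [(isOpen_lt continuous_const Complex.continuous_re).mem_nhds hs'] with z hz
      using Complex.Gamma_eq_integral hz
  have hreal : HasDerivAt Real.Gamma (∫ t in Set.Ioi 0, Real.log t * gammaWeight s t) s := by
    have := hd2.real_of_complex
    simpa [Complex.Gamma_ofReal] using this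
  have hlog := hreal.log (Real.Gamma_pos_of_pos hs).ne'
  rw [digamma, hlog.deriv, mul_div_cancel₀ _ (Real.Gamma_pos_of_pos hs).ne']

lemma pow_mul_log_mul_gammaWeight (α : ℝ) (k : ℕ) {t : ℝ} (ht : 0 < t) :
    t ^ k * Real.log t * gammaWeight α t = Real.log t * gammaWeight (α + k) t := by
  have h := pow_mul_gammaWeight α k ht
  rw [mul_right_comm, h, gammaWeight]; ring

lemma integrableOn_pow_mul_log_mul_gammaWeight {α : ℝ} (hα : 0 < α) (k : ℕ) :
    IntegrableOn (fun t => t ^ k * Real.log t * gammaWeight α t) (Set.Ioi 0) :=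
  (integrableOn_and_integral_log_mul_gammaWeight (by positivity : 0 < α + k)).1.congr_fun
    (fun _ ht => (pow_mul_log_mul_gammaWeight α k ht).symm) measurableSet_Ioi

lemma integral_pow_mul_log_mul_gammaWeight {α : ℝ} (hα : 0 < α) (k : ℕ) :
    ∫ t in Set.Ioi 0, t ^ k * Real.log t * gammaWeight α t =
      Real.Gamma (α + k) * digamma (α + k) := by
  rw [← (integrableOn_and_integral_log_mul_gammaWeight (by positivity : 0 < α + k)).2]
  exact setIntegral_congr_fun measurableSet_Ioi fun _ ht => pow_mul_log_mul_gammaWeight α k ht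

lemma Gamma_add_natCast {x : ℝ} (hx : 0 < x) (j : ℕ) :
    Real.Gamma (x + j) = (ascPochhammer ℝ j).eval x * Real.Gamma x := by
  induction j with
  | zero => simp
  | succ j ih =>
    rw [ascPochhammer_succ_eval, Nat.cast_succ, ← add_assoc,
      Real.Gamma_add_one (by positivity), ih]
    ring

/-- The coefficient of `t ^ i` in `laguerre n α`. -/
def laguerreCoeff (n : ℕ) (α : ℝ) (i : ℕ) : ℝ :=
  (-1) ^ (n - i) / (i.factorial * (n - i).factorial * Real.Gamma (α + i))

open Polynomial in
/-- The Laguerre polynomial of degree `n` for the weight `t ^ (α - 1) e ^ (-t)`, normalized so that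
its pairing with `t ^ n` is `1`. -/
def laguerre (n : ℕ) (α : ℝ) : ℝ[X] :=
  ∑ i ∈ Finset.range (n + 1), C (laguerreCoeff n α i) * X ^ i

lemma eval_laguerre (n : ℕ) (α t : ℝ) :
    (laguerre n α).eval t = ∑ i ∈ Finset.range (n + 1), laguerreCoeff n α i * t ^ i := by
  simp [laguerre, Polynomial.eval_finsetSum]

lemma natDegree_laguerre_le (n : ℕ) (α : ℝ) : (laguerre n α).natDegree ≤ n := by
  refine Polynomial.natDegree_sum_le_of_forall_le _ _ fun i hi => ?_
  exact (Polynomial.natDegree_C_mul_X_pow_le _ _).trans (Finset.mem_range_succ_iff.mp hi)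

lemma coeff_laguerre (n : ℕ) (α : ℝ) : (laguerre n α).coeff n = laguerreCoeff n α n := by
  simp [laguerre, Polynomial.finsetSum_coeff, Polynomial.coeff_X_pow]

lemma laguerreCoeff_self_ne_zero (n : ℕ) {α : ℝ} (hα : 0 < α) : laguerreCoeff n α n ≠ 0 := by
  have := Real.Gamma_pos_of_pos (by positivity : 0 < α + n)
  unfold laguerreCoeff
  positivity

lemma sum_laguerreCoeff_mul_Gamma (n j : ℕ) {α : ℝ} (hα : 0 < α) :
    ∑ i ∈ Finset.range (n + 1), laguerreCoeff n α i * Real.Gamma (α + (i + j : ℕ)) =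
      (n.factorial : ℝ)⁻¹ *
        (fwdDiff 1)^[n] ((ascPochhammer ℝ j).comp (Polynomial.X + Polynomial.C α)).eval 0 := by
  rw [fwdDiff_iter_eq_sum_shift, Finset.mul_sum]
  refine Finset.sum_congr rfl fun i hi => ?_
  have hi' : i ≤ n := Finset.mem_range_succ_iff.mp hi
  have hpos : 0 < α + i := by positivity
  have hΓ := (Real.Gamma_pos_of_pos hpos).ne'
  rw [show α + ((i + j : ℕ) : ℝ) = (α + i) + j by push_cast; ring, Gamma_add_natCast hpos,
    laguerreCoeff, zsmul_eq_mul]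
  push_cast
  rw [Nat.cast_choose ℝ hi']
  simp only [Polynomial.eval_comp, Polynomial.eval_add, Polynomial.eval_X, Polynomial.eval_C,
    nsmul_eq_mul, mul_one, zero_add]
  rw [add_comm α]
  have h1 : ((n.factorial : ℝ)) ≠ 0 := by positivity
  rw [add_comm α] at hΓ
  field_simp

lemma natDegree_ascPochhammer_comp (j : ℕ) (α : ℝ) :
    ((ascPochhammer ℝ j).comp (Polynomial.X + Polynomial.C α)).natDegree = j := by
  rw [Polynomial.natDegree_comp, ascPochhammer_natDegree, Polynomial.natDegree_X_add_C, mul_one]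

/-- The pairing of `t ^ j` with the Laguerre polynomial is an `n`-th finite difference of a
polynomial of degree `j`. -/
lemma sum_laguerreCoeff_mul_Gamma_eq_zero {n j : ℕ} (hj : j < n) {α : ℝ} (hα : 0 < α) :
    ∑ i ∈ Finset.range (n + 1), laguerreCoeff n α i * Real.Gamma (α + (i + j : ℕ)) = 0 := by
  rw [sum_laguerreCoeff_mul_Gamma n j hα, Polynomial.fwdDiff_iter_eq_zero_of_degree_lt
    (by rwa [natDegree_ascPochhammer_comp])]
  simp

lemma sum_laguerreCoeff_mul_Gamma_self (n : ℕ) {α : ℝ} (hα : 0 < α) :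
    ∑ i ∈ Finset.range (n + 1), laguerreCoeff n α i * Real.Gamma (α + (i + n : ℕ)) = 1 := by
  have h := Polynomial.fwdDiff_iter_degree_eq_factorial
    ((ascPochhammer ℝ n).comp (Polynomial.X + Polynomial.C α))
  have hm : ((ascPochhammer ℝ n).comp (Polynomial.X + Polynomial.C α)).leadingCoeff = 1 :=
    (monic_ascPochhammer ℝ n).comp_X_add_C α
  rw [natDegree_ascPochhammer_comp, hm] at h
  rw [sum_laguerreCoeff_mul_Gamma n n hα, h]
  simp [Nat.factorial_ne_zero]

/-- Integration of `f` against the Laguerre polynomial, given the moments of `f`. -/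
lemma integral_mul_laguerre {f : ℝ → ℝ} (n : ℕ) {α : ℝ}
    (hf : ∀ i : ℕ, IntegrableOn (fun t => f t * t ^ i * gammaWeight α t) (Set.Ioi 0)) :
    ∫ t in Set.Ioi 0, f t * gammaWeight α t * (laguerre n α).eval t =
      ∑ i ∈ Finset.range (n + 1),
        laguerreCoeff n α i * ∫ t in Set.Ioi 0, f t * t ^ i * gammaWeight α t := by
  simp_rw [← integral_const_mul]
  rw [← integral_finsetSum _ fun i _ => (hf i).const_mul _]
  congr 1 with t
  rw [eval_laguerre, Finset.mul_sum]
  exact Finset.sum_congr rfl fun i _ => by ring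

lemma integral_pow_mul_laguerre (n j : ℕ) {α : ℝ} (hα : 0 < α) :
    ∫ t in Set.Ioi 0, t ^ j * gammaWeight α t * (laguerre n α).eval t =
      ∑ i ∈ Finset.range (n + 1), laguerreCoeff n α i * Real.Gamma (α + (i + j : ℕ)) := by
  have h : ∀ i : ℕ, ∀ t : ℝ, t ^ j * t ^ i * gammaWeight α t = t ^ (i + j) * gammaWeight α t :=
    fun i t => by ring
  rw [integral_mul_laguerre n fun i => by
    simp_rw [h]; exact integrableOn_pow_mul_gammaWeight hα _]
  simp_rw [h, integral_pow_mul_gammaWeight hα]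

lemma integral_pow_mul_log_mul_laguerre (n j : ℕ) {α : ℝ} (hα : 0 < α) :
    ∫ t in Set.Ioi 0, t ^ j * Real.log t * gammaWeight α t * (laguerre n α).eval t =
      ∑ i ∈ Finset.range (n + 1), laguerreCoeff n α i *
        (Real.Gamma (α + (i + j : ℕ)) * digamma (α + (i + j : ℕ))) := by
  have h : ∀ i : ℕ, ∀ t : ℝ, t ^ j * Real.log t * t ^ i * gammaWeight α t =
      t ^ (i + j) * Real.log t * gammaWeight α t := fun i t => by ring
  rw [integral_mul_laguerre n fun i => by
    simp_rw [h]; exact integrableOn_pow_mul_log_mul_gammaWeight hα _]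
  simp_rw [h, integral_pow_mul_log_mul_gammaWeight hα]

/-! ### Integrals of products of determinants -/

lemma det_mul_det_eq_sum {ι X : Type*} [Fintype ι] [DecidableEq ι] (φ χ : ι → X → ℝ)
    (x : ι → X) :
    (Matrix.of fun i j => φ j (x i)).det * (Matrix.of fun i j => χ j (x i)).det =
      ∑ σ : Equiv.Perm ι, ((Equiv.Perm.sign σ : ℤ) : ℝ) *
        (Matrix.of fun i j => φ j (x i) * χ (σ i) (x i)).det := by
  rw [← Matrix.det_transpose (Matrix.of fun i j => χ j (x i)),
    Matrix.det_apply' (Matrix.transpose _), Finset.mul_sum]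
  refine Finset.sum_congr rfl fun σ _ => ?_
  have h := Matrix.det_mul_column (fun i => χ (σ i) (x i)) (Matrix.of fun i j => φ j (x i))
  simp only [Matrix.of_apply, Matrix.transpose_apply] at h ⊢
  simp_rw [mul_comm (φ _ _)]
  rw [h]
  ring

section Andreief

variable {ι X : Type*} [Fintype ι] [DecidableEq ι] [MeasurableSpace X] {μ : Measure X}
  [SigmaFinite μ]

lemma integrable_det {a : ι → ι → X → ℝ} (ha : ∀ i j, Integrable (a i j) μ) :
    Integrable (fun x : ι → X => (Matrix.of fun i j => a i j (x i)).det)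
      (Measure.pi fun _ => μ) := by
  simp_rw [← Matrix.det_transpose (Matrix.of _), Matrix.det_apply']
  refine integrable_finsetSum _ fun σ _ => Integrable.const_mul ?_ _
  exact Integrable.fintype_prod fun i => ha i (σ i)

lemma integral_det {a : ι → ι → X → ℝ} (ha : ∀ i j, Integrable (a i j) μ) :
    ∫ x : ι → X, (Matrix.of fun i j => a i j (x i)).det ∂(Measure.pi fun _ => μ) =
      (Matrix.of fun i j => ∫ t, a i j t ∂μ).det := by
  simp_rw [← Matrix.det_transpose (Matrix.of _), Matrix.det_apply']
  rw [integral_finsetSum _ fun σ _ => Integrable.const_mul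
    (Integrable.fintype_prod fun i => ha i (σ i)) _]
  refine Finset.sum_congr rfl fun σ _ => ?_
  rw [integral_const_mul]
  congr 1
  exact integral_fintype_prod_eq_prod (fun i => a i (σ i))

lemma integrable_det_mul_det {φ χ : ι → X → ℝ}
    (h : ∀ j k, Integrable (fun t => φ j t * χ k t) μ) :
    Integrable (fun x : ι → X => (Matrix.of fun i j => φ j (x i)).det *
      (Matrix.of fun i j => χ j (x i)).det) (Measure.pi fun _ => μ) := by
  simp_rw [det_mul_det_eq_sum]
  exact integrable_finsetSum _ fun σ _ => Integrable.const_mul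
    (integrable_det (a := fun i j t => φ j t * χ (σ i) t) fun i j => h j (σ i)) _

/-- Andréief's identity. -/
lemma integral_det_mul_det {φ χ : ι → X → ℝ}
    (h : ∀ j k, Integrable (fun t => φ j t * χ k t) μ) :
    ∫ x : ι → X, (Matrix.of fun i j => φ j (x i)).det *
      (Matrix.of fun i j => χ j (x i)).det ∂(Measure.pi fun _ => μ) =
      (Fintype.card ι).factorial * (Matrix.of fun j k => ∫ t, φ j t * χ k t ∂μ).det := by
  simp_rw [det_mul_det_eq_sum]
  rw [integral_finsetSum _ fun σ _ => Integrable.const_mul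
    (integrable_det (a := fun i j t => φ j t * χ (σ i) t) fun i j => h j (σ i)) _]
  have hσ : ∀ σ : Equiv.Perm ι,
      ∫ x : ι → X, ((Equiv.Perm.sign σ : ℤ) : ℝ) *
        (Matrix.of fun i j => φ j (x i) * χ (σ i) (x i)).det ∂(Measure.pi fun _ => μ) =
      (Matrix.of fun j k => ∫ t, φ j t * χ k t ∂μ).det := by
    intro σ
    rw [integral_const_mul,
      integral_det (a := fun i j t => φ j t * χ (σ i) t) fun i j => h j (σ i)]
    have hp := Matrix.det_permute σ (Matrix.of fun k j => ∫ t, φ j t * χ k t ∂μ)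
    have ht := Matrix.det_transpose (Matrix.of fun j k => ∫ t, φ j t * χ k t ∂μ)
    have hs : ((Equiv.Perm.sign σ : ℤ) : ℝ) * ((Equiv.Perm.sign σ : ℤ) : ℝ) = 1 := by
      rcases Int.units_eq_one_or (Equiv.Perm.sign σ) with h | h <;> simp [h]
    rw [show (Matrix.of fun i j => ∫ t, φ j t * χ (σ i) t ∂μ) =
      (Matrix.of fun k j => ∫ t, φ j t * χ k t ∂μ).submatrix σ id from rfl, hp, ← mul_assoc, hs,
      one_mul]
    exact ht
  rw [Finset.sum_congr rfl fun σ _ => hσ σ]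
  simp [Fintype.card_perm]

end Andreief

/-! ### Divided differences averaged over the Laguerre ensemble -/

lemma restrict_orthant (m : ℕ) :
    (volume : Measure (Fin m → ℝ)).restrict {x | ∀ i, 0 ≤ x i} =
      Measure.pi fun _ => (volume : Measure ℝ).restrict (Set.Ioi 0) := by
  have h : {x : Fin m → ℝ | ∀ i, 0 ≤ x i} = Set.univ.pi fun _ => Set.Ici 0 := by
    ext x; simp [Pi.le_def]
  rw [h, volume_pi, Measure.restrict_pi_pi]
  simp_rw [← restrict_Ioi_eq_restrict_Ici]

/-- All products of `f` with powers are integrable against the gamma weight on `(0, ∞)`. This is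
what makes the divided difference of `f` integrable over the Laguerre ensemble. -/
def GammaIntegrable (α : ℝ) (f : ℝ → ℝ) : Prop :=
  ∀ k : ℕ, IntegrableOn (fun t => f t * t ^ k * gammaWeight α t) (Set.Ioi 0)

lemma gammaIntegrable_pow {α : ℝ} (hα : 0 < α) (j : ℕ) : GammaIntegrable α fun t => t ^ j := by
  intro k
  simp_rw [← pow_add]
  exact integrableOn_pow_mul_gammaWeight hα _

lemma gammaIntegrable_pow_mul_log {α : ℝ} (hα : 0 < α) (j : ℕ) :
    GammaIntegrable α fun t => t ^ j * Real.log t := by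
  intro k
  refine (integrableOn_pow_mul_log_mul_gammaWeight hα (j + k)).congr_fun (fun t _ => ?_)
    measurableSet_Ioi
  ring

lemma GammaIntegrable.mul_eval {α : ℝ} {f : ℝ → ℝ} (hf : GammaIntegrable α f)
    (P : Polynomial ℝ) :
    IntegrableOn (fun t => f t * gammaWeight α t * P.eval t) (Set.Ioi 0) := by
  simp_rw [Polynomial.eval_eq_sum_range, Finset.mul_sum]
  refine integrable_finsetSum _ fun i _ => ((hf i).const_mul (P.coeff i)).congr ?_
  exact ae_of_all _ fun t => by simp only; ring

/-- The density of the Laguerre ensemble with parameter `α` on `[0, ∞) ^ m`, up to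
normalization. -/
def laguerreWeight {m : ℕ} (α : ℝ) (x : Fin m → ℝ) : ℝ :=
  weight α 1 x * Real.exp (-∑ i, x i)

lemma prod_gammaWeight {m : ℕ} (α : ℝ) (x : Fin m → ℝ) :
    ∏ i, gammaWeight α (x i) = (∏ i, x i ^ (α - 1)) * Real.exp (-∑ i, x i) := by
  simp_rw [gammaWeight]
  rw [Finset.prod_mul_distrib, ← Real.exp_sum, Finset.sum_neg_distrib]

/-- One of the two Vandermonde determinants absorbs the divided difference; in the other one, column
operations turn the last column into the Laguerre polynomial, up to its leading coefficient. -/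
lemma dividedDifference_mul_laguerreWeight {n : ℕ} {α : ℝ} (hα : 0 < α) (f : ℝ → ℝ)
    (x : Fin (n + 1) → ℝ) :
    dividedDifference f x * laguerreWeight α x =
      (laguerreCoeff n α n)⁻¹ *
        ((Matrix.of fun i j => monomialsSnoc n f j (x i) * gammaWeight α (x i)).det *
          (Matrix.of fun i j =>
            monomialsSnoc n (fun t => (laguerre n α).eval t) j (x i)).det) := by
  have h1 := det_borderedVandermonde_eval (laguerre n α) (natDegree_laguerre_le n α) x
  rw [coeff_laguerre, borderedVandermonde] at h1
  have h2 := Matrix.det_mul_column (fun i => gammaWeight α (x i)) (borderedVandermonde f x)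
  simp only [borderedVandermonde, Matrix.of_apply] at h2
  simp_rw [mul_comm (monomialsSnoc n f _ _)]
  rw [h2, h1, laguerreWeight, ← mul_assoc, dividedDifference_mul_weight, prod_gammaWeight,
    borderedVandermonde]
  field_simp [laguerreCoeff_self_ne_zero n hα]

lemma integrable_monomialsSnoc_mul {n : ℕ} {α : ℝ} (hα : 0 < α) {f : ℝ → ℝ}
    (hf : GammaIntegrable α f) (j k : Fin (n + 1)) :
    Integrable (fun t => monomialsSnoc n f j t * gammaWeight α t *
      monomialsSnoc n (fun t => (laguerre n α).eval t) k t) (volume.restrict (Set.Ioi 0)) := by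
  have hP : ∃ P : Polynomial ℝ,
      monomialsSnoc n (fun t => (laguerre n α).eval t) k = fun t => P.eval t := by
    refine Fin.lastCases ⟨laguerre n α, by simp⟩ (fun k => ⟨Polynomial.X ^ (k : ℕ), by simp⟩) k
  obtain ⟨P, hP⟩ := hP
  rw [hP]
  refine Fin.lastCases ?_ (fun j => ?_) j
  · simpa [IntegrableOn] using hf.mul_eval P
  · simpa [IntegrableOn] using (gammaIntegrable_pow hα (j : ℕ)).mul_eval P

lemma integrable_dividedDifference {n : ℕ} {α : ℝ} (hα : 0 < α) {f : ℝ → ℝ}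
    (hf : GammaIntegrable α f) :
    Integrable (fun x : Fin (n + 1) → ℝ => dividedDifference f x * laguerreWeight α x)
      (volume.restrict {x | ∀ i, 0 ≤ x i}) := by
  rw [restrict_orthant]
  simp_rw [dividedDifference_mul_laguerreWeight hα]
  exact (integrable_det_mul_det (φ := fun j t => monomialsSnoc n f j t * gammaWeight α t)
    (integrable_monomialsSnoc_mul hα hf)).const_mul _

/-- In Andréief's determinant the last column is `(0, …, 0, ∫ f L w)`, since the Laguerre
polynomial `L` is orthogonal to lower powers; the complementary minor does not involve `f`. -/
lemma exists_integral_dividedDifference (n : ℕ) {α : ℝ} (hα : 0 < α) :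
    ∃ c : ℝ, ∀ f : ℝ → ℝ, GammaIntegrable α f →
      ∫ x : Fin (n + 1) → ℝ in {x | ∀ i, 0 ≤ x i}, dividedDifference f x * laguerreWeight α x =
        c * ∫ t in Set.Ioi 0, f t * gammaWeight α t * (laguerre n α).eval t := by
  refine ⟨(laguerreCoeff n α n)⁻¹ * ((n + 1).factorial *
    (Matrix.of fun j k : Fin n => ∫ t in Set.Ioi 0,
      t ^ (j : ℕ) * gammaWeight α t * t ^ (k : ℕ)).det), fun f hf => ?_⟩
  rw [restrict_orthant]
  simp_rw [dividedDifference_mul_laguerreWeight hα]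
  rw [integral_const_mul, integral_det_mul_det
    (φ := fun j t => monomialsSnoc n f j t * gammaWeight α t)
    (integrable_monomialsSnoc_mul hα hf), Fintype.card_fin, mul_assoc, mul_assoc]
  congr 2
  rw [Matrix.det_succ_column _ (Fin.last n), Finset.sum_eq_single (Fin.last n)]
  · have hs : (-1 : ℝ) ^ (n + n) = 1 := by rw [← two_mul]; simp
    simp only [Fin.val_last, hs, one_mul, Matrix.of_apply, monomialsSnoc_last]
    rw [mul_comm]
    congr 2
    ext j k
    simp
  · intro j _ hj
    obtain ⟨j, rfl⟩ := Fin.exists_castSucc_eq.mpr hj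
    have h0 := integral_pow_mul_laguerre n j hα
    rw [sum_laguerreCoeff_mul_Gamma_eq_zero j.2 hα] at h0
    simp [h0]
  · simp

/-! ### Polar decomposition of the orthant along the simplex -/

lemma hyperplanePoint_succ (n : ℕ) (y : Fin n → ℝ) :
    hyperplanePoint (n + 1) y = Fin.snoc (α := fun _ => ℝ) y (1 - ∑ j, y j) := by
  ext i
  refine Fin.lastCases ?_ (fun i => ?_) i
  · simp [hyperplanePoint]
  · simp [hyperplanePoint]

lemma measurable_hyperplanePoint (m : ℕ) : Measurable (hyperplanePoint m) := by
  refine measurable_pi_lambda _ fun i => ?_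
  unfold hyperplanePoint
  by_cases h : (i : ℕ) < m - 1
  · simp only [h, dite_true]; fun_prop
  · simp only [h, dite_false]; fun_prop

/-- The measure `δ(1 - ∑ λ_j) dλ` on the simplex. -/
def simplexMeasure (m : ℕ) : Measure (Fin m → ℝ) :=
  (deltaMeasure m).restrict {x | ∀ i, 0 ≤ x i}

instance (m : ℕ) : SFinite (simplexMeasure m) := by
  unfold simplexMeasure deltaMeasure; infer_instance

lemma measurableSet_orthant (m : ℕ) : MeasurableSet {x : Fin m → ℝ | ∀ i, 0 ≤ x i} := by
  measurability

lemma ae_simplexMeasure (n : ℕ) :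
    ∀ᵐ x ∂(simplexMeasure (n + 1)), (∀ i, 0 ≤ x i) ∧ ∑ i, x i = 1 := by
  refine (ae_restrict_mem (measurableSet_orthant _)).and (ae_restrict_of_ae ?_)
  rw [deltaMeasure, ae_map_iff (measurable_hyperplanePoint _).aemeasurable
    (measurableSet_eq_fun (by fun_prop) (by fun_prop))]
  refine ae_of_all _ fun y => ?_
  rw [hyperplanePoint_succ n y, Fin.sum_univ_castSucc]
  simp

lemma measurable_snoc (n : ℕ) :
    Measurable fun p : (Fin n → ℝ) × ℝ => Fin.snoc (α := fun _ => ℝ) p.1 p.2 := by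
  refine measurable_pi_lambda _ fun i => ?_
  refine Fin.lastCases ?_ (fun i => ?_) i
  · simpa using measurable_snd
  · simp only [Fin.snoc_castSucc]; fun_prop

/-- Shearing the last variable to the sum of the coordinates. -/
lemma lintegral_eq_lintegral_snoc_sub_sum {n : ℕ} {G : (Fin (n + 1) → ℝ) → ℝ≥0∞}
    (hG : Measurable G) :
    ∫⁻ x, G x = ∫⁻ s : ℝ, ∫⁻ y : Fin n → ℝ,
      G (Fin.snoc (α := fun _ => ℝ) y (s - ∑ j, y j)) := by
  have hmp := (volume_preserving_piFinSuccAbove (fun _ : Fin (n + 1) => ℝ) (Fin.last n)).symm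
  rw [← hmp.lintegral_comp_emb (MeasurableEquiv.measurableEmbedding _) G]
  have hsn : ∀ p : ℝ × (Fin n → ℝ),
      (MeasurableEquiv.piFinSuccAbove (fun _ : Fin (n + 1) => ℝ) (Fin.last n)).symm p =
        Fin.snoc (α := fun _ => ℝ) p.2 p.1 := by
    intro p
    simp [MeasurableEquiv.piFinSuccAbove, Fin.insertNthEquiv]
  simp_rw [hsn]
  have hm : Measurable fun p : ℝ × (Fin n → ℝ) => G (Fin.snoc (α := fun _ => ℝ) p.2 p.1) :=
    hG.comp ((measurable_snoc n).comp measurable_swap)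
  rw [Measure.volume_eq_prod, lintegral_prod_symm _ hm.aemeasurable]
  have hshift : ∀ y : Fin n → ℝ, ∫⁻ t, G (Fin.snoc (α := fun _ => ℝ) y t) =
      ∫⁻ s : ℝ, G (Fin.snoc (α := fun _ => ℝ) y (s - ∑ j, y j)) := fun y =>
    (lintegral_sub_right_eq_self (fun t => G (Fin.snoc (α := fun _ => ℝ) y t)) (∑ j, y j)).symm
  rw [lintegral_congr hshift, lintegral_lintegral_swap]
  exact (hG.comp ((measurable_snoc n).comp (by fun_prop :
    Measurable fun p : (Fin n → ℝ) × ℝ => (p.1, p.2 - ∑ j, p.1 j)))).aemeasurable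

lemma lintegral_snoc_eq_of_pos {n : ℕ} {G : (Fin (n + 1) → ℝ) → ℝ≥0∞} (hG : Measurable G)
    {s : ℝ} (hs : 0 < s) :
    ∫⁻ y : Fin n → ℝ, G (Fin.snoc (α := fun _ => ℝ) y (s - ∑ j, y j)) =
      ENNReal.ofReal (s ^ n) * ∫⁻ x, G (s • x) ∂(deltaMeasure (n + 1)) := by
  have hm : Measurable fun y : Fin n → ℝ =>
      G (Fin.snoc (α := fun _ => ℝ) y (s - ∑ j, y j)) :=
    hG.comp ((measurable_snoc n).comp (by fun_prop :
      Measurable fun y : Fin n → ℝ => (y, s - ∑ j, y j)))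
  have hmap := Measure.map_addHaar_smul (volume : Measure (Fin n → ℝ)) hs.ne'
  have h1 : ∫⁻ y : Fin n → ℝ, G (Fin.snoc (α := fun _ => ℝ) (s • y) (s - ∑ j, (s • y) j)) =
      ENNReal.ofReal |(s ^ n)⁻¹| *
        ∫⁻ y : Fin n → ℝ, G (Fin.snoc (α := fun _ => ℝ) y (s - ∑ j, y j)) := by
    rw [← lintegral_map hm (measurable_const_smul s), hmap, lintegral_smul_measure]
    simp
  have h2 : ∀ y : Fin n → ℝ, s • hyperplanePoint (n + 1) y =
      Fin.snoc (α := fun _ => ℝ) (s • y) (s - ∑ j, (s • y) j) := by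
    intro y
    rw [hyperplanePoint_succ n y]
    ext i
    refine Fin.lastCases ?_ (fun i => ?_) i
    · simp [mul_sub, Finset.mul_sum]
    · simp
  have h3 : ∫⁻ x, G (s • x) ∂(deltaMeasure (n + 1)) =
      ∫⁻ y : Fin n → ℝ, G (Fin.snoc (α := fun _ => ℝ) (s • y) (s - ∑ j, (s • y) j)) := by
    rw [deltaMeasure, lintegral_map (f := fun x => G (s • x)) (hG.comp (measurable_const_smul s))
      (measurable_hyperplanePoint _)]
    exact lintegral_congr fun y => congrArg G (h2 y)
  rw [h3, h1, ← mul_assoc, ← ENNReal.ofReal_mul (by positivity), abs_of_pos (by positivity),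
    mul_inv_cancel₀ (by positivity), ENNReal.ofReal_one, one_mul]

/-- The measure `s ^ n ds` on `(0, ∞)`. -/
def radialMeasure (n : ℕ) : Measure ℝ :=
  (volume.restrict (Set.Ioi 0)).withDensity fun s => ENNReal.ofReal (s ^ n)

instance (n : ℕ) : SFinite (radialMeasure n) := by
  unfold radialMeasure; infer_instance

lemma lintegral_orthant {n : ℕ} {F : (Fin (n + 1) → ℝ) → ℝ≥0∞} (hF : Measurable F) :
    ∫⁻ x in {x | ∀ i, 0 ≤ x i}, F x =
      ∫⁻ s, ∫⁻ x, F (s • x) ∂(simplexMeasure (n + 1)) ∂(radialMeasure n) := by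
  have hO := measurableSet_orthant (n + 1)
  set O := {x : Fin (n + 1) → ℝ | ∀ i, 0 ≤ x i} with hOdef
  have hm : Measurable fun s : ℝ => ∫⁻ x, F (s • x) ∂(simplexMeasure (n + 1)) :=
    Measurable.lintegral_prod_right' (f := fun p : ℝ × (Fin (n + 1) → ℝ) => F (p.1 • p.2))
      (hF.comp (by fun_prop))
  rw [← lintegral_indicator hO, lintegral_eq_lintegral_snoc_sub_sum (hF.indicator hO),
    radialMeasure, lintegral_withDensity_eq_lintegral_mul _ (by fun_prop) hm,
    ← lintegral_indicator measurableSet_Ioi]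
  refine lintegral_congr_ae ?_
  filter_upwards [Measure.ae_ne volume (0 : ℝ)] with s hs
  rcases lt_or_gt_of_ne hs with h | h
  · -- a vector with negative coordinate sum lies outside the orthant
    rw [Set.indicator_of_notMem (by simpa using h.le)]
    have hz : ∀ y : Fin n → ℝ,
        O.indicator F (Fin.snoc (α := fun _ => ℝ) y (s - ∑ j, y j)) = 0 := by
      intro y
      refine Set.indicator_of_notMem (fun hy => ?_) _
      have hsum := Finset.sum_nonneg fun i (_ : i ∈ Finset.univ) => hy i
      rw [Fin.sum_univ_castSucc] at hsum
      simp at hsum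
      linarith
    simp [hz]
  · rw [lintegral_snoc_eq_of_pos (hF.indicator hO) h, Set.indicator_of_mem (by simpa using h)]
    simp only [Pi.mul_apply]
    rw [simplexMeasure, ← lintegral_indicator hO]
    congr 2 with x
    have hiff : s • x ∈ O ↔ x ∈ O := by
      simp [hOdef, mul_nonneg_iff_of_pos_left h]
    by_cases hx : x ∈ O
    · rw [Set.indicator_of_mem hx, Set.indicator_of_mem (hiff.mpr hx)]
    · rw [Set.indicator_of_notMem hx, Set.indicator_of_notMem (hx ∘ hiff.mp)]

lemma map_smul_radialMeasure_prod_simplexMeasure (n : ℕ) :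
    ((radialMeasure n).prod (simplexMeasure (n + 1))).map
      (fun p : ℝ × (Fin (n + 1) → ℝ) => p.1 • p.2) = volume.restrict {x | ∀ i, 0 ≤ x i} := by
  refine Measure.ext_of_lintegral _ fun F hF => ?_
  have hsm : Measurable fun p : ℝ × (Fin (n + 1) → ℝ) => p.1 • p.2 := by fun_prop
  rw [lintegral_map hF hsm, lintegral_prod (fun p => F (p.1 • p.2)) (hF.comp hsm).aemeasurable,
     lintegral_orthant hF]

lemma ae_radialMeasure_pos (n : ℕ) : ∀ᵐ s ∂(radialMeasure n), 0 < s :=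
  withDensity_absolutelyContinuous _ _ (ae_restrict_mem measurableSet_Ioi)

lemma radialMeasure_ne_zero (n : ℕ) : radialMeasure n ≠ 0 := by
  intro h
  have h1 := ae_radialMeasure_pos n
  have h2 : radialMeasure n Set.univ = 0 := by simp [h]
  rw [radialMeasure, withDensity_apply _ MeasurableSet.univ, Measure.restrict_univ,
    lintegral_eq_zero_iff (by fun_prop)] at h2
  have h3 : ∀ᵐ s : ℝ ∂(volume.restrict (Set.Ioi 0)), False := by
    filter_upwards [h2, ae_restrict_mem measurableSet_Ioi] with s hs hs0
    simp only [Pi.zero_apply, ENNReal.ofReal_eq_zero] at hs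
    exact absurd hs (not_le.mpr (pow_pos hs0 n))
  rw [eventually_false_iff_eq_bot, ae_eq_bot, Measure.restrict_eq_zero] at h3
  simp at h3

lemma integrable_of_integrable_mul_prod {X Y : Type*} [MeasurableSpace X] [MeasurableSpace Y]
    {μ : Measure X} {ν : Measure Y} [SFinite μ] [SFinite ν] (hμ : μ ≠ 0) {f : X → ℝ} {g : Y → ℝ}
    (hf : ∀ᵐ x ∂μ, f x ≠ 0) (h : Integrable (fun p : X × Y => f p.1 * g p.2) (μ.prod ν)) :
    Integrable g ν := by
  have : NeBot (ae μ) := ae_neBot.mpr hμ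
  obtain ⟨x, hx0, hx⟩ := (hf.and h.prod_right_ae).exists
  exact (integrable_const_mul_iff (isUnit_iff_ne_zero.mpr hx0) g).mp hx

lemma integrable_radialMeasure_iff (n : ℕ) (h : ℝ → ℝ) :
    Integrable h (radialMeasure n) ↔ IntegrableOn (fun s => s ^ n * h s) (Set.Ioi 0) := by
  rw [radialMeasure, integrable_withDensity_iff_integrable_smul₀' (by fun_prop)
    (ae_of_all _ fun _ => ENNReal.ofReal_lt_top)]
  refine integrable_congr ?_
  filter_upwards [ae_restrict_mem measurableSet_Ioi] with s hs
  rw [ENNReal.toReal_ofReal (pow_nonneg (le_of_lt hs) _), smul_eq_mul]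

lemma integral_radialMeasure (n : ℕ) (h : ℝ → ℝ) :
    ∫ s, h s ∂(radialMeasure n) = ∫ s in Set.Ioi 0, s ^ n * h s := by
  rw [radialMeasure, integral_withDensity_eq_integral_toReal_smul (by fun_prop)
    (ae_of_all _ fun _ => ENNReal.ofReal_lt_top)]
  refine setIntegral_congr_fun measurableSet_Ioi fun s hs => ?_
  rw [ENNReal.toReal_ofReal (pow_nonneg (le_of_lt hs) _), smul_eq_mul]

/-! ### The averages over the simplex -/

/-- The radial factor of the Laguerre density. -/
def radialFactor (n : ℕ) (α s : ℝ) : ℝ := s ^ ((n + 1) * (n + α - 1)) * Real.exp (-s)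

lemma laguerreWeight_smul {n : ℕ} (α : ℝ) {s : ℝ} (hs : 0 < s) {x : Fin (n + 1) → ℝ}
    (hpos : ∀ i, 0 ≤ x i) (hsum : ∑ i, x i = 1) :
    laguerreWeight α (s • x) = radialFactor n α s * weight α 1 x := by
  rw [laguerreWeight, weight_smul α hs hpos, radialFactor]
  simp only [Pi.smul_apply, smul_eq_mul, ← Finset.mul_sum, hsum, mul_one]
  ring

/-- Together with `s ^ n ds`, the radial factor is the gamma density of parameter
`(n + 1) (n + α)`. -/
lemma pow_mul_radialFactor (n : ℕ) (α : ℝ) {s : ℝ} (hs : 0 < s) :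
    s ^ n * radialFactor n α s = gammaWeight ((n + 1) * (n + α)) s := by
  rw [radialFactor, gammaWeight, ← mul_assoc, ← Real.rpow_natCast, ← Real.rpow_add hs]
  congr 2
  ring

lemma radialParameter_pos (n : ℕ) {α : ℝ} (hα : 0 < α) : 0 < ((n : ℝ) + 1) * (n + α) := by
  positivity

lemma integral_pow_mul_radialFactor (n k : ℕ) {α : ℝ} (hα : 0 < α) :
    ∫ s, s ^ k * radialFactor n α s ∂(radialMeasure n) =
      Real.Gamma ((n + 1) * (n + α) + k) := by
  rw [integral_radialMeasure, ← integral_pow_mul_gammaWeight (radialParameter_pos n hα)]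
  refine setIntegral_congr_fun measurableSet_Ioi fun s hs => ?_
  rw [← pow_mul_radialFactor n α hs]; ring

lemma integrable_pow_mul_log_mul_radialFactor (n k : ℕ) {α : ℝ} (hα : 0 < α) :
    Integrable (fun s => s ^ k * Real.log s * radialFactor n α s) (radialMeasure n) := by
  rw [integrable_radialMeasure_iff]
  refine (integrableOn_pow_mul_log_mul_gammaWeight (radialParameter_pos n hα) k).congr_fun
    (fun s hs => ?_) measurableSet_Ioi
  dsimp only
  rw [← pow_mul_radialFactor n α hs]; ring

lemma integral_pow_mul_log_mul_radialFactor (n k : ℕ) {α : ℝ} (hα : 0 < α) :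
    ∫ s, s ^ k * Real.log s * radialFactor n α s ∂(radialMeasure n) =
      Real.Gamma ((n + 1) * (n + α) + k) * digamma ((n + 1) * (n + α) + k) := by
  rw [integral_radialMeasure, ← integral_pow_mul_log_mul_gammaWeight (radialParameter_pos n hα)]
  refine setIntegral_congr_fun measurableSet_Ioi fun s hs => ?_
  rw [← pow_mul_radialFactor n α hs]; ring

lemma radialFactor_ne_zero (n : ℕ) (α : ℝ) {s : ℝ} (hs : 0 < s) : radialFactor n α s ≠ 0 := by
  unfold radialFactor; positivity

lemma ae_prod_pos (n : ℕ) :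
    ∀ᵐ p ∂((radialMeasure n).prod (simplexMeasure (n + 1))),
      0 < p.1 ∧ (∀ i, 0 ≤ p.2 i) ∧ ∑ i, p.2 i = 1 :=
  (Measure.quasiMeasurePreserving_fst.ae (ae_radialMeasure_pos n)).and
    (Measure.quasiMeasurePreserving_snd.ae (ae_simplexMeasure n))

lemma integrable_comp_smul {n : ℕ} {H : (Fin (n + 1) → ℝ) → ℝ}
    (hH : Integrable H (volume.restrict {x | ∀ i, 0 ≤ x i})) :
    Integrable (fun p : ℝ × (Fin (n + 1) → ℝ) => H (p.1 • p.2))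
      ((radialMeasure n).prod (simplexMeasure (n + 1))) := by
  rw [← map_smul_radialMeasure_prod_simplexMeasure] at hH
  exact hH.comp_measurable (by fun_prop)

lemma integral_comp_smul {n : ℕ} {H : (Fin (n + 1) → ℝ) → ℝ}
    (hH : Integrable H (volume.restrict {x | ∀ i, 0 ≤ x i})) :
    ∫ p, H (p.1 • p.2) ∂((radialMeasure n).prod (simplexMeasure (n + 1))) =
      ∫ x in {x | ∀ i, 0 ≤ x i}, H x := by
  rw [← map_smul_radialMeasure_prod_simplexMeasure] at hH ⊢
  rw [integral_map (by fun_prop) hH.aestronglyMeasurable]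

lemma injective_smul_iff {m : ℕ} {s : ℝ} (hs : 0 < s) {x : Fin m → ℝ} :
    Function.Injective (s • x) ↔ Function.Injective x := by
  refine ⟨fun h i j hij => h (by simp [hij]), fun h i j hij => h ?_⟩
  simpa [hs.ne'] using hij

lemma dividedDifference_pow_smul_mul {n : ℕ} (α : ℝ) {s : ℝ} (hs : 0 < s)
    {x : Fin (n + 1) → ℝ} (hpos : ∀ i, 0 ≤ x i) (hsum : ∑ i, x i = 1) :
    dividedDifference (fun t => t ^ n) (s • x) * laguerreWeight α (s • x) =
      s ^ 0 * radialFactor n α s * weight α 1 x := by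
  rw [laguerreWeight_smul α hs hpos hsum]
  by_cases hx : Function.Injective x
  · rw [dividedDifference_pow ((injective_smul_iff hs).mpr hx)]; ring
  · rw [weight_eq_zero_of_not_injective α hx]; simp

lemma dividedDifference_pow_succ_smul_mul {n : ℕ} (α : ℝ) {s : ℝ} (hs : 0 < s)
    {x : Fin (n + 1) → ℝ} (hpos : ∀ i, 0 ≤ x i) (hsum : ∑ i, x i = 1) :
    dividedDifference (fun t => t ^ (n + 1)) (s • x) * laguerreWeight α (s • x) =
      s ^ 1 * radialFactor n α s * weight α 1 x := by
  rw [laguerreWeight_smul α hs hpos hsum]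
  by_cases hx : Function.Injective x
  · rw [dividedDifference_pow_succ ((injective_smul_iff hs).mpr hx)]
    simp only [Pi.smul_apply, smul_eq_mul, ← Finset.mul_sum, hsum]
    ring
  · rw [weight_eq_zero_of_not_injective α hx]; simp

lemma dividedDifference_log_smul_mul {n : ℕ} (α : ℝ) {s : ℝ} (hs : 0 < s)
    {x : Fin (n + 1) → ℝ} (hpos : ∀ i, 0 ≤ x i) (hsum : ∑ i, x i = 1) :
    dividedDifference (fun t => t ^ (n + 1) * Real.log t) (s • x) * laguerreWeight α (s • x) =
      s ^ 1 * Real.log s * radialFactor n α s * weight α 1 x -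
        s ^ 1 * radialFactor n α s * (subentropyFormula x * weight α 1 x) := by
  rw [laguerreWeight_smul α hs hpos hsum]
  by_cases hx : Function.Injective x
  · have h := subentropyFormula_smul hs hx hsum hpos
    rw [subentropyFormula_eq_neg_dividedDifference (s • x), neg_eq_iff_eq_neg] at h
    rw [h]; ring
  · rw [weight_eq_zero_of_not_injective α hx]; simp

lemma integrable_weight (n : ℕ) {α : ℝ} (hα : 0 < α) :
    Integrable (weight (m := n + 1) α 1) (simplexMeasure (n + 1)) := by
  have h := integrable_comp_smul
    (integrable_dividedDifference (n := n) hα (gammaIntegrable_pow hα n))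
  refine integrable_of_integrable_mul_prod (f := fun s => s ^ 0 * radialFactor n α s)
    (radialMeasure_ne_zero n) ?_ (h.congr ?_)
  · filter_upwards [ae_radialMeasure_pos n] with s hs
    simpa using radialFactor_ne_zero n α hs
  · filter_upwards [ae_prod_pos n] with p hp
    exact dividedDifference_pow_smul_mul α hp.1 hp.2.1 hp.2.2

lemma integrable_log_mul_prod (n : ℕ) {α : ℝ} (hα : 0 < α) :
    Integrable (fun p : ℝ × (Fin (n + 1) → ℝ) =>
      p.1 ^ 1 * Real.log p.1 * radialFactor n α p.1 * weight α 1 p.2)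
      ((radialMeasure n).prod (simplexMeasure (n + 1))) :=
  (integrable_pow_mul_log_mul_radialFactor n 1 hα).mul_prod (integrable_weight n hα)

lemma integrable_subentropyFormula_mul_prod (n : ℕ) {α : ℝ} (hα : 0 < α) :
    Integrable (fun p : ℝ × (Fin (n + 1) → ℝ) =>
      p.1 ^ 1 * radialFactor n α p.1 * (subentropyFormula p.2 * weight α 1 p.2))
      ((radialMeasure n).prod (simplexMeasure (n + 1))) := by
  have h := integrable_comp_smul
    (integrable_dividedDifference (n := n) hα (gammaIntegrable_pow_mul_log hα (n + 1)))
  refine ((integrable_log_mul_prod n hα).sub h).congr ?_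
  filter_upwards [ae_prod_pos n] with p hp
  rw [Pi.sub_apply, dividedDifference_log_smul_mul α hp.1 hp.2.1 hp.2.2]
  ring

lemma integrable_subentropyFormula_mul_weight (n : ℕ) {α : ℝ} (hα : 0 < α) :
    Integrable (fun x : Fin (n + 1) → ℝ => subentropyFormula x * weight α 1 x)
      (simplexMeasure (n + 1)) := by
  refine integrable_of_integrable_mul_prod (f := fun s => s ^ 1 * radialFactor n α s)
    (radialMeasure_ne_zero n) ?_ (integrable_subentropyFormula_mul_prod n hα)
  filter_upwards [ae_radialMeasure_pos n] with s hs
  simpa using ⟨hs.ne', radialFactor_ne_zero n α hs⟩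

lemma integral_dividedDifference_pow (n : ℕ) {α : ℝ} (hα : 0 < α) :
    ∫ x : Fin (n + 1) → ℝ in {x | ∀ i, 0 ≤ x i},
      dividedDifference (fun t => t ^ n) x * laguerreWeight α x =
      Real.Gamma ((n + 1) * (n + α)) * ∫ x, weight α 1 x ∂(simplexMeasure (n + 1)) := by
  have h := integral_pow_mul_radialFactor n 0 hα
  rw [Nat.cast_zero, add_zero] at h
  rw [← integral_comp_smul (integrable_dividedDifference hα (gammaIntegrable_pow hα n)), ← h,
    ← integral_prod_mul]
  refine integral_congr_ae ?_
  filter_upwards [ae_prod_pos n] with p hp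
  exact dividedDifference_pow_smul_mul α hp.1 hp.2.1 hp.2.2

lemma integral_dividedDifference_pow_succ (n : ℕ) {α : ℝ} (hα : 0 < α) :
    ∫ x : Fin (n + 1) → ℝ in {x | ∀ i, 0 ≤ x i},
      dividedDifference (fun t => t ^ (n + 1)) x * laguerreWeight α x =
      Real.Gamma ((n + 1) * (n + α) + 1) *
        ∫ x, weight α 1 x ∂(simplexMeasure (n + 1)) := by
  have h := integral_pow_mul_radialFactor n 1 hα
  rw [Nat.cast_one] at h
  rw [← integral_comp_smul (integrable_dividedDifference hα (gammaIntegrable_pow hα (n + 1))),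
    ← h, ← integral_prod_mul]
  refine integral_congr_ae ?_
  filter_upwards [ae_prod_pos n] with p hp
  exact dividedDifference_pow_succ_smul_mul α hp.1 hp.2.1 hp.2.2

lemma integral_dividedDifference_log (n : ℕ) {α : ℝ} (hα : 0 < α) :
    ∫ x : Fin (n + 1) → ℝ in {x | ∀ i, 0 ≤ x i},
      dividedDifference (fun t => t ^ (n + 1) * Real.log t) x * laguerreWeight α x =
      Real.Gamma ((n + 1) * (n + α) + 1) * (digamma ((n + 1) * (n + α) + 1) *
        ∫ x, weight α 1 x ∂(simplexMeasure (n + 1)) -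
        ∫ x, subentropyFormula x * weight α 1 x ∂(simplexMeasure (n + 1))) := by
  have h0 := integral_pow_mul_radialFactor n 1 hα
  have h1 := integral_pow_mul_log_mul_radialFactor n 1 hα
  rw [Nat.cast_one] at h0 h1
  rw [mul_sub, ← mul_assoc, ← h1, ← h0, ← integral_prod_mul, ← integral_prod_mul,
    ← integral_sub (integrable_log_mul_prod n hα) (integrable_subentropyFormula_mul_prod n hα),
    ← integral_comp_smul
      (integrable_dividedDifference hα (gammaIntegrable_pow_mul_log hα (n + 1)))]
  refine integral_congr_ae ?_
  filter_upwards [ae_prod_pos n] with p hp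
  exact dividedDifference_log_smul_mul α hp.1 hp.2.1 hp.2.2

lemma weight_nonneg {m : ℕ} (α : ℝ) {x : Fin m → ℝ} (hx : ∀ i, 0 ≤ x i) : 0 ≤ weight α 1 x := by
  rw [weight_one]
  exact mul_nonneg (sq_nonneg _) (Finset.prod_nonneg fun i _ => Real.rpow_nonneg (hx i) _)

lemma dividedDifference_pow_mul_laguerreWeight {n : ℕ} (α : ℝ) (x : Fin (n + 1) → ℝ) :
    dividedDifference (fun t => t ^ n) x * laguerreWeight α x = laguerreWeight α x := by
  by_cases hx : Function.Injective x
  · rw [dividedDifference_pow hx, one_mul]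
  · simp [laguerreWeight, weight_eq_zero_of_not_injective α hx]

/-- The Laguerre density is positive on the nonempty open set of positive vectors with pairwise
distinct entries. -/
lemma integral_laguerreWeight_pos (n : ℕ) {α : ℝ} (hα : 0 < α) :
    0 < ∫ x : Fin (n + 1) → ℝ in {x | ∀ i, 0 ≤ x i},
      dividedDifference (fun t => t ^ n) x * laguerreWeight α x := by
  have hint := integrable_dividedDifference (n := n) hα (gammaIntegrable_pow hα n)
  simp_rw [dividedDifference_pow_mul_laguerreWeight] at hint ⊢
  rw [setIntegral_pos_iff_support_of_nonneg_ae ?_ hint]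
  · set U : Set (Fin (n + 1) → ℝ) :=
      {x | (Matrix.vandermonde x).det ≠ 0} ∩ ⋂ i, {x | 0 < x i} with hU
    have hopen : IsOpen U := by
      refine IsOpen.inter (isOpen_ne_fun ?_ continuous_const)
        (isOpen_iInter_of_finite fun i => isOpen_lt continuous_const (continuous_apply i))
      simp_rw [Matrix.det_vandermonde]
      fun_prop
    have hne : U.Nonempty := by
      refine ⟨fun i => (i : ℝ) + 1, ?_, ?_⟩
      · refine Matrix.det_vandermonde_ne_zero_iff.mpr fun i j hij => ?_
        have : ((i : ℕ) : ℝ) = (j : ℕ) := by simpa using hij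
        exact Fin.ext (by exact_mod_cast this)
      · simp only [Set.mem_iInter, Set.mem_ofPred_eq]
        intro i; positivity
    refine (hopen.measure_pos volume hne).trans_le (measure_mono fun x hx => ?_)
    obtain ⟨hx1, hx2⟩ := hx
    simp only [Set.mem_iInter, Set.mem_ofPred_eq] at hx1 hx2
    refine ⟨?_, fun i => (hx2 i).le⟩
    have hprod : 0 < ∏ j, x j ^ (α - 1) :=
      Finset.prod_pos fun j _ => Real.rpow_pos_of_pos (hx2 j) _
    rw [Function.mem_support, laguerreWeight, weight_one]
    positivity
  · filter_upwards [ae_restrict_mem (measurableSet_orthant (n + 1))] with x hx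
    exact mul_nonneg (weight_nonneg α hx) (Real.exp_pos _).le

lemma integral_weight_pos (n : ℕ) {α : ℝ} (hα : 0 < α) :
    0 < ∫ x, weight α 1 x ∂(simplexMeasure (n + 1)) := by
  have h := integral_laguerreWeight_pos n hα
  rw [integral_dividedDifference_pow n hα] at h
  exact (mul_pos_iff_of_pos_left (Real.Gamma_pos_of_pos (radialParameter_pos n hα))).mp h

lemma u_succ_eq {n i : ℕ} (hi : i ≤ n) (α : ℝ) :
    u (n + 1) (n - i) α = laguerreCoeff n α i * Real.Gamma (α + (i + (n + 1) : ℕ)) := by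
  obtain ⟨k, rfl⟩ := Nat.exists_eq_add_of_le hi
  rw [u, laguerreCoeff, Nat.add_sub_cancel_left]
  push_cast
  rw [show (2 : ℝ) * (i + k + 1 - 1) + α + 1 - k = α + (i + (i + k + 1)) by ring,
    show (i : ℝ) + k + 1 - k = i + 1 by ring,
    show (i : ℝ) + k + 1 + α - 1 - k = α + i by ring, Real.Gamma_nat_eq_factorial,
    Real.Gamma_nat_eq_factorial]
  ring

lemma g_succ_eq {n i : ℕ} (hi : i ≤ n) (α : ℝ) :
    g (n + 1) (n - i) α =
      digamma ((n + 1) * (n + α) + 1) - digamma (α + (i + (n + 1) : ℕ)) := by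
  obtain ⟨k, rfl⟩ := Nat.exists_eq_add_of_le hi
  rw [g, Nat.add_sub_cancel_left]
  push_cast
  congr 2 <;> ring

/-- The three averages over the Laguerre ensemble of the divided differences of `t ^ n`,
`t ^ (n + 1)` and `t ^ (n + 1) ln t` have the same normalization `c`. With
`m = n + 1`, the second one yields `∑ k, u m k α = m (m + α - 1)`. -/
lemma integral_subentropyFormula_mul_weight (n : ℕ) {α : ℝ} (hα : 0 < α) :
    ∫ x, subentropyFormula x * weight α 1 x ∂(simplexMeasure (n + 1)) =
      (1 / (((n + 1 : ℕ) : ℝ) * ((n + 1 : ℕ) + α - 1)) *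
        ∑ k ∈ Finset.range (n + 1), g (n + 1) k α * u (n + 1) k α) *
        ∫ x, weight α 1 x ∂(simplexMeasure (n + 1)) := by
  obtain ⟨c, hc⟩ := exists_integral_dividedDifference n hα
  have h1 := hc _ (gammaIntegrable_pow hα n)
  have h2 := hc _ (gammaIntegrable_pow hα (n + 1))
  have h3 := hc _ (gammaIntegrable_pow_mul_log hα (n + 1))
  rw [integral_dividedDifference_pow n hα, integral_pow_mul_laguerre n n hα,
    sum_laguerreCoeff_mul_Gamma_self n hα, mul_one] at h1
  rw [integral_dividedDifference_pow_succ n hα, integral_pow_mul_laguerre n (n + 1) hα] at h2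
  rw [integral_dividedDifference_log n hα, integral_pow_mul_log_mul_laguerre n (n + 1) hα] at h3
  have hN := radialParameter_pos n hα
  have hΓ := Real.Gamma_pos_of_pos hN
  have hsum : ∑ k ∈ Finset.range (n + 1), g (n + 1) k α * u (n + 1) k α =
      digamma ((n + 1) * (n + α) + 1) * ∑ i ∈ Finset.range (n + 1),
        laguerreCoeff n α i * Real.Gamma (α + (i + (n + 1) : ℕ)) -
      ∑ i ∈ Finset.range (n + 1), laguerreCoeff n α i *
        (Real.Gamma (α + (i + (n + 1) : ℕ)) * digamma (α + (i + (n + 1) : ℕ))) := by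
    rw [← Finset.sum_range_reflect, Finset.mul_sum, ← Finset.sum_sub_distrib]
    refine Finset.sum_congr rfl fun i hi => ?_
    have hi' : i ≤ n := Finset.mem_range_succ_iff.mp hi
    rw [Nat.add_sub_cancel, u_succ_eq hi', g_succ_eq hi']
    ring
  rw [hsum, show ((n + 1 : ℕ) : ℝ) * ((n + 1 : ℕ) + α - 1) = (n + 1) * (n + α) by
    push_cast; ring]
  rw [Real.Gamma_add_one hN.ne', ← h1] at h2 h3
  generalize (∫ x, weight α 1 x ∂(simplexMeasure (n + 1))) = W at *
  generalize (∫ x, subentropyFormula x * weight α 1 x ∂(simplexMeasure (n + 1))) = J at *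
  generalize (∑ i ∈ Finset.range (n + 1),
    laguerreCoeff n α i * Real.Gamma (α + (i + (n + 1) : ℕ))) = S at *
  generalize (∑ i ∈ Finset.range (n + 1), laguerreCoeff n α i *
    (Real.Gamma (α + (i + (n + 1) : ℕ)) * digamma (α + (i + (n + 1) : ℕ)))) = T at *
  generalize digamma ((n + 1) * (n + α) + 1) = ψ at *
  generalize ((n : ℝ) + 1) * (n + α) = N at *
  generalize Real.Gamma N = Γ at *
  have h2' : N * W = W * S := by
    apply mul_left_cancel₀ hΓ.ne'; linear_combination h2
  have h3' : N * (ψ * W - J) = W * T := by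
    apply mul_left_cancel₀ hΓ.ne'; linear_combination h3
  field_simp
  linear_combination ψ * h2' - h3'

/-! ### The eigenvalue measure -/

lemma measurable_weight {m : ℕ} (α : ℝ) : Measurable (weight (m := m) α 1) := by
  unfold weight vandermondeProd
  fun_prop

lemma measurable_subentropyFormula (m : ℕ) : Measurable (subentropyFormula (m := m)) := by
  unfold subentropyFormula
  fun_prop

lemma unnormalizedEigenvalueMeasure_univ (n : ℕ) {α : ℝ} (hα : 0 < α) :
    unnormalizedEigenvalueMeasure (n + 1) α 1 Set.univ =
      ENNReal.ofReal (∫ x, weight α 1 x ∂(simplexMeasure (n + 1))) := by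
  rw [unnormalizedEigenvalueMeasure, withDensity_apply _ MeasurableSet.univ,
    Measure.restrict_univ, ofReal_integral_eq_lintegral_ofReal (integrable_weight n hα)]
  · rfl
  · filter_upwards [ae_simplexMeasure n] with x hx using weight_nonneg α hx.1

lemma eigenvalueMeasure_eq (n : ℕ) {α : ℝ} (hα : 0 < α) :
    eigenvalueMeasure (n + 1) α 1 =
      (ENNReal.ofReal (∫ x, weight α 1 x ∂(simplexMeasure (n + 1))))⁻¹ •
        (simplexMeasure (n + 1)).withDensity fun x => ENNReal.ofReal (weight α 1 x) := by
  rw [eigenvalueMeasure, unnormalizedEigenvalueMeasure_univ n hα]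
  rfl

lemma isProbabilityMeasure_eigenvalueMeasure (n : ℕ) {α : ℝ} (hα : 0 < α) :
    IsProbabilityMeasure (eigenvalueMeasure (n + 1) α 1) := by
  constructor
  rw [eigenvalueMeasure, Measure.smul_apply, unnormalizedEigenvalueMeasure_univ n hα, smul_eq_mul]
  exact ENNReal.inv_mul_cancel (by simpa using integral_weight_pos n hα) ENNReal.ofReal_ne_top

/-- The weight vanishes where eigenvalues coincide. -/
lemma ae_injective_eigenvalueMeasure (n : ℕ) {α : ℝ} (hα : 0 < α) :
    ∀ᵐ x ∂(eigenvalueMeasure (n + 1) α 1), Function.Injective x := by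
  rw [eigenvalueMeasure_eq n hα]
  refine Measure.ae_smul_measure ?_ _
  rw [ae_withDensity_iff (measurable_weight α).ennreal_ofReal]
  refine ae_of_all _ fun x hx => ?_
  by_contra h
  exact hx (by rw [weight_eq_zero_of_not_injective α h, ENNReal.ofReal_zero])

lemma integrable_subentropyFormula (n : ℕ) {α : ℝ} (hα : 0 < α) :
    Integrable (subentropyFormula (m := n + 1)) (eigenvalueMeasure (n + 1) α 1) := by
  rw [eigenvalueMeasure_eq n hα]
  refine Integrable.smul_measure ?_ (by simpa using integral_weight_pos n hα)
  rw [integrable_withDensity_iff_integrable_smul₀' (measurable_weight α).ennreal_ofReal.aemeasurable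
    (ae_of_all _ fun _ => ENNReal.ofReal_lt_top)]
  refine (integrable_subentropyFormula_mul_weight n hα).congr ?_
  filter_upwards [ae_simplexMeasure n] with x hx
  rw [ENNReal.toReal_ofReal (weight_nonneg α hx.1), smul_eq_mul, mul_comm]

lemma integral_subentropyFormula (n : ℕ) {α : ℝ} (hα : 0 < α) :
    ∫ x, subentropyFormula x ∂(eigenvalueMeasure (n + 1) α 1) =
      1 / (((n + 1 : ℕ) : ℝ) * ((n + 1 : ℕ) + α - 1)) *
        ∑ k ∈ Finset.range (n + 1), g (n + 1) k α * u (n + 1) k α := by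
  have hW := integral_weight_pos n hα
  rw [eigenvalueMeasure_eq n hα, integral_smul_measure,
    integral_withDensity_eq_integral_toReal_smul (measurable_weight α).ennreal_ofReal
    (ae_of_all _ fun _ => ENNReal.ofReal_lt_top)]
  have h : ∫ x : Fin (n + 1) → ℝ, (ENNReal.ofReal (weight α 1 x)).toReal • subentropyFormula x
        ∂(simplexMeasure (n + 1)) =
      ∫ x, subentropyFormula x * weight α 1 x ∂(simplexMeasure (n + 1)) := by
    refine integral_congr_ae ?_
    filter_upwards [ae_simplexMeasure n] with x hx
    rw [ENNReal.toReal_ofReal (weight_nonneg α hx.1), smul_eq_mul, mul_comm]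
  rw [h, integral_subentropyFormula_mul_weight n hα, ENNReal.toReal_inv,
    ENNReal.toReal_ofReal hW.le, smul_eq_mul]
  field_simp

lemma subentropy_ae_eq (n : ℕ) {α : ℝ} (hα : 0 < α) :
    subentropy =ᵐ[eigenvalueMeasure (n + 1) α 1] subentropyFormula := by
  filter_upwards [ae_injective_eigenvalueMeasure n hα] with x hx
  rw [subentropy, if_pos hx]

/-! ### Density matrices -/

lemma isHermitian_conjDiagonal {m : ℕ} (x : Fin m → ℝ) (U : Matrix.unitaryGroup (Fin m) ℂ) :
    (conjDiagonal x U).IsHermitian := by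
  refine Matrix.isHermitian_mul_mul_conjTranspose _ ?_
  exact Matrix.isHermitian_diagonal_of_self_adjoint _ (by ext i; simp)

lemma charpoly_conjDiagonal {m : ℕ} (x : Fin m → ℝ) (U : Matrix.unitaryGroup (Fin m) ℂ) :
    (conjDiagonal x U).charpoly = ∏ i, (Polynomial.X - Polynomial.C (x i : ℂ)) := by
  have h : (U : Matrix (Fin m) (Fin m) ℂ).conjTranspose * (U : Matrix (Fin m) (Fin m) ℂ) = 1 :=
    Matrix.mem_unitaryGroup_iff'.mp U.2
  rw [conjDiagonal, Matrix.charpoly_mul_comm, ← mul_assoc, h, one_mul, Matrix.charpoly_diagonal]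

lemma exists_perm_of_multiset_map_eq {m : ℕ} {x y : Fin m → ℝ}
    (h : Multiset.map y Finset.univ.val = Multiset.map x Finset.univ.val) :
    ∃ σ : Equiv.Perm (Fin m), y = x ∘ σ := by
  classical
  have hcount : ∀ (z : Fin m → ℝ) (c : ℝ),
      Fintype.card {i // z i = c} = Multiset.count c (Multiset.map z Finset.univ.val) := by
    intro z c
    rw [Multiset.count_map, Fintype.card_subtype]
    simp_rw [eq_comm (a := c)]
    rfl
  have hcard : ∀ c, Nonempty ({i // y i = c} ≃ {i // x i = c}) := fun c =>
    Fintype.card_eq.mp (by rw [hcount, hcount, h])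
  refine ⟨Equiv.ofFiberEquiv fun c => (hcard c).some, ?_⟩
  ext i
  exact (Equiv.ofFiberEquiv_map (fun c => (hcard c).some) i).symm

lemma exists_perm_eigenvalues_conjDiagonal {m : ℕ} (x : Fin m → ℝ)
    (U : Matrix.unitaryGroup (Fin m) ℂ) :
    ∃ σ : Equiv.Perm (Fin m), (isHermitian_conjDiagonal x U).eigenvalues = x ∘ σ := by
  have h := (isHermitian_conjDiagonal x U).roots_charpoly_eq_eigenvalues
  rw [charpoly_conjDiagonal, Polynomial.roots_prod _ _
    (by simp [Finset.prod_ne_zero_iff, Polynomial.X_sub_C_ne_zero])] at h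
  simp only [Polynomial.roots_X_sub_C, Multiset.bind_singleton] at h
  refine exists_perm_of_multiset_map_eq ?_
  have h2 := congrArg (Multiset.map Complex.re) h
  simpa [Multiset.map_map, Function.comp_def] using h2.symm

lemma range_conjDiagonal (m : ℕ) :
    (Set.range fun p : (Fin m → ℝ) × Matrix.unitaryGroup (Fin m) ℂ => conjDiagonal p.1 p.2) =
      {ρ | ρ.IsHermitian} := by
  ext ρ
  refine ⟨?_, fun h => ⟨(Matrix.IsHermitian.eigenvalues h, Matrix.IsHermitian.eigenvectorUnitary h),
    (Matrix.IsHermitian.spectral_theorem h).symm⟩⟩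
  rintro ⟨p, rfl⟩
  exact isHermitian_conjDiagonal p.1 p.2

instance polishSpace_unitaryGroup (m : ℕ) : PolishSpace (Matrix.unitaryGroup (Fin m) ℂ) := by
  have : PolishSpace (Matrix (Fin m) (Fin m) ℂ) :=
    inferInstanceAs (PolishSpace (Fin m → Fin m → ℂ))
  exact (isClosed_unitary (R := Matrix (Fin m) (Fin m) ℂ)).polishSpace

instance secondCountableTopology_matrix (m : ℕ) :
    SecondCountableTopology (Matrix (Fin m) (Fin m) ℂ) :=
  inferInstanceAs (SecondCountableTopology (Fin m → Fin m → ℂ))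

lemma measurable_conjDiagonal (m : ℕ) :
    Measurable fun p : (Fin m → ℝ) × Matrix.unitaryGroup (Fin m) ℂ => conjDiagonal p.1 p.2 := by
  refine Continuous.measurable ?_
  unfold conjDiagonal
  fun_prop

lemma measurableSet_isHermitian (m : ℕ) :
    MeasurableSet {ρ : Matrix (Fin m) (Fin m) ℂ | ρ.IsHermitian} :=
  (isClosed_eq (by fun_prop) continuous_id :
    IsClosed {ρ : Matrix (Fin m) (Fin m) ℂ | ρ.IsHermitian}).measurableSet

/-- The map `(Λ, U) ↦ U Λ U†` is a Borel map between standard Borel spaces, so measurability of a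
set of Hermitian matrices can be tested on its preimage (Lusin separation). This avoids any
regularity statement about the eigenvalues of a matrix. -/
lemma measurableSet_of_preimage_conjDiagonal {m : ℕ} {s : Set (Matrix (Fin m) (Fin m) ℂ)}
    (hs : s ⊆ {ρ | ρ.IsHermitian})
    (h : MeasurableSet ((fun p : (Fin m → ℝ) × Matrix.unitaryGroup (Fin m) ℂ =>
      conjDiagonal p.1 p.2) ⁻¹' s)) : MeasurableSet s := by
  rw [(measurable_conjDiagonal m).measurableSet_preimage_iff_inter_range
    (by rw [range_conjDiagonal]; exact measurableSet_isHermitian m), range_conjDiagonal,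
    Set.inter_eq_left.mpr hs] at h
  exact h

open Classical in
/-- The defining expression of the subentropy, evaluated at the eigenvalues of a matrix, without
the passage to the limit at coinciding eigenvalues. Matrices that are not Hermitian get `0`. -/
def matrixSubentropyFormula {m : ℕ} (ρ : Matrix (Fin m) (Fin m) ℂ) : ℝ :=
  if h : ρ.IsHermitian then subentropyFormula h.eigenvalues else 0

lemma matrixSubentropyFormula_conjDiagonal {m : ℕ} (x : Fin m → ℝ)
    (U : Matrix.unitaryGroup (Fin m) ℂ) :
    matrixSubentropyFormula (conjDiagonal x U) = subentropyFormula x := by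
  obtain ⟨σ, hσ⟩ := exists_perm_eigenvalues_conjDiagonal x U
  rw [matrixSubentropyFormula, dif_pos (isHermitian_conjDiagonal x U), hσ,
    subentropyFormula_eq_neg_dividedDifference, subentropyFormula_eq_neg_dividedDifference,
    dividedDifference_comp_perm]

lemma measurable_matrixSubentropyFormula (m : ℕ) :
    Measurable (matrixSubentropyFormula (m := m)) := by
  intro B hB
  have h1 : MeasurableSet (matrixSubentropyFormula ⁻¹' B ∩ {ρ | ρ.IsHermitian} :
      Set (Matrix (Fin m) (Fin m) ℂ)) := by
    refine measurableSet_of_preimage_conjDiagonal Set.inter_subset_right ?_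
    have : (fun p : (Fin m → ℝ) × Matrix.unitaryGroup (Fin m) ℂ => conjDiagonal p.1 p.2) ⁻¹'
        (matrixSubentropyFormula ⁻¹' B ∩ {ρ | ρ.IsHermitian}) =
        (fun p => subentropyFormula p.1) ⁻¹' B := by
      ext p
      simp [matrixSubentropyFormula_conjDiagonal, isHermitian_conjDiagonal]
    rw [this]
    exact ((measurable_subentropyFormula m).comp measurable_fst) hB
  have h2 : MeasurableSet (matrixSubentropyFormula ⁻¹' B ∩ {ρ | ρ.IsHermitian}ᶜ :
      Set (Matrix (Fin m) (Fin m) ℂ)) := by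
    have : (matrixSubentropyFormula ⁻¹' B ∩ {ρ | ρ.IsHermitian}ᶜ :
        Set (Matrix (Fin m) (Fin m) ℂ)) = {_ρ | (0 : ℝ) ∈ B} ∩ {ρ | ρ.IsHermitian}ᶜ := by
      ext ρ
      refine and_congr_left fun hρ => ?_
      rw [Set.mem_preimage, matrixSubentropyFormula,
        dif_neg (show ¬ρ.IsHermitian from hρ)]
      rfl
    rw [this]
    exact (MeasurableSet.const _).inter (measurableSet_isHermitian m).compl
  have h := h1.union h2
  rwa [Set.inter_union_compl] at h

/-- The Hermitian matrices with simple spectrum. -/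
def simpleSpectrum (m : ℕ) : Set (Matrix (Fin m) (Fin m) ℂ) :=
  {ρ | ∃ h : ρ.IsHermitian, Function.Injective h.eigenvalues}

lemma conjDiagonal_mem_simpleSpectrum_iff {m : ℕ} (x : Fin m → ℝ)
    (U : Matrix.unitaryGroup (Fin m) ℂ) :
    conjDiagonal x U ∈ simpleSpectrum m ↔ Function.Injective x := by
  obtain ⟨σ, hσ⟩ := exists_perm_eigenvalues_conjDiagonal x U
  refine ⟨fun ⟨_, h⟩ => ?_, fun h => ⟨isHermitian_conjDiagonal x U, ?_⟩⟩
  · rw [hσ] at h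
    simpa using h
  · rw [hσ]
    exact h.comp σ.injective

lemma measurableSet_injective (m : ℕ) : MeasurableSet {x : Fin m → ℝ | Function.Injective x} := by
  have : {x : Fin m → ℝ | Function.Injective x} = {x | (Matrix.vandermonde x).det ≠ 0} := by
    ext x; exact Matrix.det_vandermonde_ne_zero_iff.symm
  rw [this]
  refine (isOpen_ne_fun ?_ continuous_const).measurableSet
  simp_rw [Matrix.det_vandermonde]
  fun_prop

lemma measurableSet_simpleSpectrum (m : ℕ) : MeasurableSet (simpleSpectrum m) := by
  refine measurableSet_of_preimage_conjDiagonal (fun ρ h => h.1) ?_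
  have : (fun p : (Fin m → ℝ) × Matrix.unitaryGroup (Fin m) ℂ => conjDiagonal p.1 p.2) ⁻¹'
      simpleSpectrum m = Prod.fst ⁻¹' {x : Fin m → ℝ | Function.Injective x} := by
    ext p
    exact conjDiagonal_mem_simpleSpectrum_iff p.1 p.2
  rw [this]
  exact measurable_fst (measurableSet_injective m)

instance isProbabilityMeasure_unitaryHaar (m : ℕ) : IsProbabilityMeasure (unitaryHaar m) :=
  ⟨Measure.haarMeasure_self⟩

lemma matrixSubentropy_ae_eq (n : ℕ) {α : ℝ} (hα : 0 < α) :
    matrixSubentropy =ᵐ[stateMeasure (n + 1) α 1] matrixSubentropyFormula := by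
  have := isProbabilityMeasure_eigenvalueMeasure n hα
  have h : ∀ᵐ ρ ∂(stateMeasure (n + 1) α 1), ρ ∈ simpleSpectrum (n + 1) := by
    rw [stateMeasure, ae_map_iff (p := fun ρ => ρ ∈ simpleSpectrum (n + 1))
      (measurable_conjDiagonal _).aemeasurable (measurableSet_simpleSpectrum _)]
    filter_upwards [Measure.quasiMeasurePreserving_fst.ae
      (ae_injective_eigenvalueMeasure n hα)] with p hp
    exact (conjDiagonal_mem_simpleSpectrum_iff p.1 p.2).mpr hp
  filter_upwards [h] with ρ hρ
  obtain ⟨h1, h2⟩ := hρ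
  rw [matrixSubentropy, matrixSubentropyFormula, dif_pos h1, dif_pos h1, subentropy, if_pos h2]

lemma integrable_matrixSubentropyFormula (n : ℕ) {α : ℝ} (hα : 0 < α) :
    Integrable (matrixSubentropyFormula (m := n + 1)) (stateMeasure (n + 1) α 1) := by
  rw [stateMeasure, integrable_map_measure
    (measurable_matrixSubentropyFormula _).aestronglyMeasurable
    (measurable_conjDiagonal _).aemeasurable]
  have := isProbabilityMeasure_eigenvalueMeasure n hα
  refine ((integrable_subentropyFormula n hα).comp_fst (unitaryHaar (n + 1))).congr ?_
  exact ae_of_all _ fun p => (matrixSubentropyFormula_conjDiagonal p.1 p.2).symm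

lemma integral_matrixSubentropyFormula (n : ℕ) {α : ℝ} (hα : 0 < α) :
    ∫ ρ, matrixSubentropyFormula ρ ∂(stateMeasure (n + 1) α 1) =
      ∫ x, subentropyFormula x ∂(eigenvalueMeasure (n + 1) α 1) := by
  have := isProbabilityMeasure_eigenvalueMeasure n hα
  rw [stateMeasure, integral_map (measurable_conjDiagonal _).aemeasurable
    (measurable_matrixSubentropyFormula _).aestronglyMeasurable]
  simp_rw [matrixSubentropyFormula_conjDiagonal]
  rw [integral_fun_fst]
  simp

end RandomState

end

theorem proposition1 (m : ℕ) (hm : 1 ≤ m) (α : ℝ) (hα : 0 < α) :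
    IsProbabilityMeasure (RandomState.eigenvalueMeasure m α 1) ∧
    (Integrable (RandomState.subentropy (m := m)) (RandomState.eigenvalueMeasure m α 1) ∧
      ∫ x, RandomState.subentropy x ∂(RandomState.eigenvalueMeasure m α 1) =
        1 / (m * (m + α - 1)) *
          ∑ k ∈ Finset.range m, RandomState.g m k α * RandomState.u m k α) ∧
    (Integrable (RandomState.matrixSubentropy (m := m)) (RandomState.stateMeasure m α 1) ∧
      ∫ ρ, RandomState.matrixSubentropy ρ ∂(RandomState.stateMeasure m α 1) =
        1 / (m * (m + α - 1)) *
          ∑ k ∈ Finset.range m, RandomState.g m k α * RandomState.u m k α) := by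
  obtain ⟨n, rfl⟩ := Nat.exists_eq_add_of_le' hm
  have hQ := RandomState.subentropy_ae_eq n hα
  have hM := RandomState.matrixSubentropy_ae_eq n hα
  refine ⟨RandomState.isProbabilityMeasure_eigenvalueMeasure n hα, ⟨?_, ?_⟩, ⟨?_, ?_⟩⟩
  · exact (RandomState.integrable_subentropyFormula n hα).congr hQ.symm
  · rw [integral_congr_ae hQ, RandomState.integral_subentropyFormula n hα]
  · exact (RandomState.integrable_matrixSubentropyFormula n hα).congr hM.symm
  · rw [integral_congr_ae hM, RandomState.integral_matrixSubentropyFormula n hα,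
      RandomState.integral_subentropyFormula n hα]
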